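/- Let $HG$ be the Heawood graph, i.e. the graph with vertices $u_i, v_i$ ($i\in\mathbb Z/7$) and the $21$ edges $u_iv_i$, $u_iv_{i-1}$, $v_iu_{i-2}$, regarded as a topological space in the usual way. A plane generic immersion of $HG$ is a continuous, locally injective map $f: HG\to\mathbb R^2$ whose multiple points (points of the plane with more than one preimage) are only finitely many transversal double points between edges; that is, each multiple point has exactly two preimages, neither of them a vertex, and in suitable local coordinates of the plane (given by a homeomorphism) the two branches of $f$ through it are the two coordinate axes. The distance $d(d,e)$ of two edges $d,e$ is the minimum number of edges of a path joining an end of $d$ to an end of $e$, and $D_2(HG)$ is the set of unordered pairs of edges of $HG$ at distance $2$. Then for every plane generic immersion $f: HG\to\mathbb R^2$, $$\sum_{(d,e)\in D_2(HG)} |f(d)\cap f(e)| \equiv 1 \pmod 2 .$$ -/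

import Mathlib

open Filter Topology

namespace SimpleGraph

/-- The underlying topological space of a finite simple graph `G`: its standard geometric
realization, with the subspace topology of `V → ℝ`. Its points are given in barycentric
coordinates: a point is a vertex, or lies on the segment spanned by the two ends of an edge. -/
def Realization {V : Type*} [Fintype V] (G : SimpleGraph V) : Type _ :=
  {x : V → ℝ // x ∈ stdSimplex ℝ V ∧
    ((∃ v : V, Function.support x ⊆ {v}) ∨ ∃ e ∈ G.edgeSet, Function.support x ⊆ (e : Set V))}

instance {V : Type*} [Fintype V] (G : SimpleGraph V) : TopologicalSpace G.Realization :=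
  inferInstanceAs (TopologicalSpace (Subtype _))

/-- The set of those points of the graph that are vertices. -/
def vertexPoints {V : Type*} [Fintype V] (G : SimpleGraph V) : Set G.Realization :=
  {x | ∃ v : V, Function.support x.1 ⊆ {v}}

/-- The edge `e` as a closed arc (ends included) in the space of the graph. -/
def edgeArc {V : Type*} [Fintype V] (G : SimpleGraph V) (e : Sym2 V) : Set G.Realization :=
  {x | Function.support x.1 ⊆ (e : Set V)}

/-- Two germs of `f : X → ℝ²`, at `x` and at `y`, with the same value meet transversally: in
suitable local coordinates `φ` of the plane around this value, small neighbourhoods of `x` and `y`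
are mapped onto neighbourhoods of the origin in the horizontal and in the vertical axis.
This covers transversal crossings of smooth arcs and of polygonal arcs. -/
def CrossTransversally {X : Type*} [TopologicalSpace X] (f : X → EuclideanSpace ℝ (Fin 2))
    (x y : X) : Prop :=
  ∃ φ : OpenPartialHomeomorph (EuclideanSpace ℝ (Fin 2)) (ℝ × ℝ),
    f x ∈ φ.source ∧ f y = f x ∧ φ (f x) = 0 ∧
    Filter.map (fun z => φ (f z)) (𝓝 x) = 𝓝[{q : ℝ × ℝ | q.2 = 0}] 0 ∧
    Filter.map (fun z => φ (f z)) (𝓝 y) = 𝓝[{q : ℝ × ℝ | q.1 = 0}] 0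

/-- The points of the plane with more than one preimage. -/
def multiplePoints {X : Type*} (f : X → EuclideanSpace ℝ (Fin 2)) :
    Set (EuclideanSpace ℝ (Fin 2)) :=
  {p | (f ⁻¹' {p}).Nontrivial}

/-- Plane generic immersions of a finite simple graph: continuous, locally injective maps to the
plane whose multiple points are only finitely many transversal double points between (interiors
of) edges. -/
structure IsPlaneGenericImmersion {V : Type*} [Fintype V] (G : SimpleGraph V)
    (f : G.Realization → EuclideanSpace ℝ (Fin 2)) : Prop where
  continuous : Continuous f
  locally_injective : ∀ x, ∃ U ∈ 𝓝 x, Set.InjOn f U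
  finite_multiplePoints : (multiplePoints f).Finite
  transversal_double : ∀ p ∈ multiplePoints f, ∃ x y : G.Realization,
    x ≠ y ∧ f ⁻¹' {p} = {x, y} ∧ x ∉ G.vertexPoints ∧ y ∉ G.vertexPoints ∧
      CrossTransversally f x y

/-- The distance of two edges: the least length of a path from an end of `d` to an end of `e`
(`⊤` if there is none). -/
noncomputable def edgeDist {V : Type*} (G : SimpleGraph V) (d e : Sym2 V) : ℕ∞ :=
  ⨅ u ∈ d, ⨅ v ∈ e, G.edist u v

open Classical in
/-- The unordered pairs of edges of `G` at distance `k`. -/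
noncomputable def edgePairsAtDist {V : Type*} [Fintype V] (G : SimpleGraph V) (k : ℕ) :
    Finset (Sym2 (Sym2 V)) :=
  Finset.univ.filter fun P =>
    ∃ d ∈ G.edgeSet, ∃ e ∈ G.edgeSet, P = s(d, e) ∧ G.edgeDist d e = k

/-- For an unordered pair of edges `d`, `e`, the number of points of `f(d) ∩ f(e)`. -/
noncomputable def crossingNumber {V : Type*} [Fintype V] (G : SimpleGraph V)
    (f : G.Realization → EuclideanSpace ℝ (Fin 2)) : Sym2 (Sym2 V) → ℕ :=
  Sym2.lift ⟨fun d e => (f '' G.edgeArc d ∩ f '' G.edgeArc e).ncard,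
    fun _ _ => congrArg Set.ncard (Set.inter_comm _ _)⟩

/-- The Heawood graph: vertices `u i = Sum.inl i` and `v i = Sum.inr i` for `i` modulo `7`, and
the 21 edges `u i v i`, `u i v (i - 1)`, `u i v (i + 2)`. -/
def heawoodGraph : SimpleGraph (ZMod 7 ⊕ ZMod 7) :=
  SimpleGraph.fromRel fun a b =>
    ∃ i : ZMod 7, a = Sum.inl i ∧ (b = Sum.inr i ∨ b = Sum.inr (i - 1) ∨ b = Sum.inr (i + 2))

end SimpleGraph

/-! For disjoint edges `d = ab` and `e = pq`, the crossings of `f(d)` and `f(e)` are the zeros of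
`F(s, t) = f(d(s)) - f(e(t))` on the unit square. Transversality gives each zero an odd local
degree, so the crossing number has the parity of the degree of `F` along the boundary of the square
(`IsPlaneGenericImmersion.exists_rectChange`).

On each side of the square one of the two points is a fixed vertex. The degree is therefore a signed
sum of changes of logarithm of an edge seen from an end of the other edge. Fixing a logarithm of
every difference of two vertices, normalized by a linear order `r` of the vertices, turns these
changes into integers `n a b v`. What remains depends on `r` only: it is the crossing number mod 2
of the chords `ab`, `pq` when the vertices lie on a convex curve in the order `r`
(`IsPlaneGenericImmersion.exists_crossingNumber_eq`).

In the Heawood graph the edges at distance two from a given edge form an 8-cycle, so each vertex is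
an end of 0 or 2 of them. Summed over all pairs at distance two, the terms `n a b v` cancel mod 2
(`sum_heawoodFar_eq_zero`). The parity is thus the same for all `f`, and a finite computation for
the convex drawing gives 1. -/

/-! ### Continuous logarithms along segments. -/

/-- A continuous nowhere vanishing complex function on a simply connected space has a continuous
logarithm. -/
theorem exists_continuous_log {X : Type*} [TopologicalSpace X] [SimplyConnectedSpace X]
    [LocallyPathConnectedSpace X] {g : X → ℂ} (hg : Continuous g) (h0 : ∀ x, g x ≠ 0) :
    ∃ L : X → ℂ, Continuous L ∧ ∀ x, Complex.exp (L x) = g x := by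
  obtain ⟨x₀⟩ : Nonempty X := inferInstance
  obtain ⟨L, ⟨-, hL⟩, -⟩ := Complex.isCoveringMapOn_exp.existsUnique_continuousMap_lifts
    ⟨g, hg⟩ (a₀ := x₀) (Complex.exp_log (h0 x₀)) h0
  exact ⟨L, L.continuous, fun x => congrFun hL x⟩

/-- A retraction of the line to a segment. -/
theorem exists_retraction_uIcc (a b : ℝ) : ∃ p : ℝ → ℝ, Continuous p ∧
    (∀ t, p t ∈ Set.uIcc a b) ∧ ∀ t ∈ Set.uIcc a b, p t = t := by
  have hle : min a b ≤ max a b := min_le_max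
  refine ⟨fun t => Set.projIcc (min a b) (max a b) hle t,
    continuous_subtype_val.comp continuous_projIcc,
    fun t => (Set.projIcc (min a b) (max a b) hle t).2, fun t ht => ?_⟩
  simp only [Set.projIcc_of_mem hle (show t ∈ Set.Icc (min a b) (max a b) from ht)]

open Set in
/-- A continuous nowhere vanishing complex function on a segment has a continuous logarithm. -/
theorem exists_log_uIcc {γ : ℝ → ℂ} {a b : ℝ} (hγ : ContinuousOn γ (uIcc a b))
    (h0 : ∀ t ∈ uIcc a b, γ t ≠ 0) :
    ∃ L : ℝ → ℂ, ContinuousOn L (uIcc a b) ∧ ∀ t ∈ uIcc a b, Complex.exp (L t) = γ t := by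
  obtain ⟨p, hpc, hpm, hpe⟩ := exists_retraction_uIcc a b
  obtain ⟨L, hL, hLe⟩ := exists_continuous_log (hγ.comp_continuous hpc hpm) fun t => h0 _ (hpm t)
  exact ⟨L, hL.continuousOn, fun t ht => by simp [hLe, hpe t ht]⟩

open Set in
/-- A continuous nowhere vanishing complex function on a rectangle has a continuous logarithm. -/
theorem exists_log_uIcc_prod {F : ℝ → ℝ → ℂ} {a b c d : ℝ}
    (hF : ContinuousOn (Function.uncurry F) (uIcc a b ×ˢ uIcc c d))
    (h0 : ∀ s ∈ uIcc a b, ∀ t ∈ uIcc c d, F s t ≠ 0) :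
    ∃ L : ℝ × ℝ → ℂ, ContinuousOn L (uIcc a b ×ˢ uIcc c d) ∧
      ∀ s ∈ uIcc a b, ∀ t ∈ uIcc c d, Complex.exp (L (s, t)) = F s t := by
  obtain ⟨p, hpc, hpm, hpe⟩ := exists_retraction_uIcc a b
  obtain ⟨q, hqc, hqm, hqe⟩ := exists_retraction_uIcc c d
  obtain ⟨L, hL, hLe⟩ := exists_continuous_log
    (hF.comp_continuous (f := fun z : ℝ × ℝ => (p z.1, q z.2)) (by fun_prop)
      (fun z => ⟨hpm _, hqm _⟩)) fun z => h0 _ (hpm _) _ (hqm _)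
  exact ⟨L, hL.continuousOn, fun s hs t ht => by
    simp [hLe, hpe s hs, hqe t ht]⟩

open Classical in
/-- The change of a continuous logarithm of `γ` from `a` to `b`. -/
noncomputable def logChange (γ : ℝ → ℂ) (a b : ℝ) : ℂ :=
  -- The choice of logarithm is immaterial by `logChange_eq`; the default `0` does not occur for `γ`
  -- continuous and nowhere zero on the segment.
  if h : ∃ L : ℝ → ℂ, ContinuousOn L (Set.uIcc a b) ∧
      ∀ t ∈ Set.uIcc a b, Complex.exp (L t) = γ t then h.choose b - h.choose a else 0

open Set in
-- Lifts through the covering `exp` of a connected set are determined by one value, so the chosen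
-- logarithm is `L` shifted by a constant.
theorem logChange_eq {γ L : ℝ → ℂ} {a b : ℝ} (hL : ContinuousOn L (uIcc a b))
    (h : ∀ t ∈ uIcc a b, Complex.exp (L t) = γ t) : logChange γ a b = L b - L a := by
  have hex : ∃ L : ℝ → ℂ, ContinuousOn L (uIcc a b) ∧
      ∀ t ∈ uIcc a b, Complex.exp (L t) = γ t := ⟨L, hL, h⟩
  rw [logChange, dif_pos hex]
  obtain ⟨h1, h2⟩ := hex.choose_spec
  set M := hex.choose
  have hne : ∀ t ∈ uIcc a b, γ t ≠ 0 := fun t ht => by rw [← h t ht]; exact Complex.exp_ne_zero _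
  have := Complex.isCoveringMap_exp.eqOn_of_comp_eqOn (isPreconnected_uIcc (a := a) (b := b))
    (g₁ := M) (g₂ := fun t => L t + (M a - L a)) h1 (hL.add continuousOn_const)
    (fun t ht => by
      apply Subtype.ext
      simp only [Function.comp]
      rw [Complex.exp_add, Complex.exp_sub, h t ht, h2 t ht, h a left_mem_uIcc,
        h2 a left_mem_uIcc, div_self (hne a left_mem_uIcc), mul_one])
    left_mem_uIcc (by simp)
  have := this right_mem_uIcc
  simp only at this
  rw [this]; ring

open Set in
theorem exp_logChange {γ : ℝ → ℂ} {a b : ℝ} (hγ : ContinuousOn γ (uIcc a b))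
    (h0 : ∀ t ∈ uIcc a b, γ t ≠ 0) : Complex.exp (logChange γ a b) = γ b / γ a := by
  obtain ⟨L, hL, h⟩ := exists_log_uIcc hγ h0
  rw [logChange_eq hL h, Complex.exp_sub, h _ left_mem_uIcc, h _ right_mem_uIcc]

open Set in
theorem logChange_congr {γ γ' : ℝ → ℂ} {a b : ℝ} (h : ∀ t ∈ uIcc a b, γ t = γ' t) :
    logChange γ a b = logChange γ' a b := by
  by_cases hex : ∃ L : ℝ → ℂ, ContinuousOn L (uIcc a b) ∧
      ∀ t ∈ uIcc a b, Complex.exp (L t) = γ t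
  · obtain ⟨L, hL, hLe⟩ := hex
    rw [logChange_eq hL hLe, logChange_eq hL fun t ht => (hLe t ht).trans (h t ht)]
  · rw [logChange, dif_neg hex, logChange, dif_neg]
    rintro ⟨L, hL, hLe⟩
    exact hex ⟨L, hL, fun t ht => (hLe t ht).trans (h t ht).symm⟩

open Set in
/-- Reparametrization. -/
theorem logChange_comp {γ : ℝ → ℂ} {g : ℝ → ℝ} {a b r s : ℝ} (hg : ContinuousOn g (uIcc a b))
    (hm : MapsTo g (uIcc a b) (uIcc r s)) (hγ : ContinuousOn γ (uIcc r s))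
    (h0 : ∀ t ∈ uIcc r s, γ t ≠ 0) :
    logChange (fun t => γ (g t)) a b = logChange γ (g a) (g b) := by
  obtain ⟨L, hL, h⟩ := exists_log_uIcc hγ h0
  have hsub : uIcc (g a) (g b) ⊆ uIcc r s :=
    uIcc_subset_uIcc (hm left_mem_uIcc) (hm right_mem_uIcc)
  rw [logChange_eq (hL.mono hsub) (fun t ht => h t (hsub ht)),
    logChange_eq (L := fun t => L (g t)) (hL.comp hg hm) (fun t ht => h _ (hm ht))]

open Set in
theorem logChange_add {γ : ℝ → ℂ} {a b c : ℝ} (hab : a ≤ b) (hbc : b ≤ c)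
    (hγ : ContinuousOn γ (Icc a c)) (h0 : ∀ t ∈ Icc a c, γ t ≠ 0) :
    logChange γ a b + logChange γ b c = logChange γ a c := by
  rw [← uIcc_of_le (hab.trans hbc)] at hγ h0
  obtain ⟨L, hL, h⟩ := exists_log_uIcc hγ h0
  have hb : b ∈ uIcc a c := by rw [uIcc_of_le (hab.trans hbc)]; exact ⟨hab, hbc⟩
  have h1 : uIcc a b ⊆ uIcc a c := uIcc_subset_uIcc left_mem_uIcc hb
  have h2 : uIcc b c ⊆ uIcc a c := uIcc_subset_uIcc hb right_mem_uIcc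
  rw [logChange_eq hL h, logChange_eq (hL.mono h1) fun t ht => h t (h1 ht),
    logChange_eq (hL.mono h2) fun t ht => h t (h2 ht)]
  ring

open Set in
theorem logChange_symm {γ : ℝ → ℂ} {a b : ℝ} (hγ : ContinuousOn γ (uIcc a b))
    (h0 : ∀ t ∈ uIcc a b, γ t ≠ 0) : logChange γ b a = -logChange γ a b := by
  obtain ⟨L, hL, h⟩ := exists_log_uIcc hγ h0
  rw [logChange_eq hL h]
  rw [uIcc_comm] at hL h
  rw [logChange_eq hL h]; ring

open Set in
theorem logChange_neg {γ : ℝ → ℂ} {a b : ℝ} (hγ : ContinuousOn γ (uIcc a b))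
    (h0 : ∀ t ∈ uIcc a b, γ t ≠ 0) : logChange (fun t => -γ t) a b = logChange γ a b := by
  obtain ⟨L, hL, h⟩ := exists_log_uIcc hγ h0
  rw [logChange_eq hL h, logChange_eq (L := fun t => L t + Real.pi * Complex.I)
    (hL.add continuousOn_const) fun t ht => by
      rw [Complex.exp_add, h t ht, Complex.exp_pi_mul_I]; ring]
  ring

/-! ### Degree along the boundary of a rectangle. -/

/-- The change of a logarithm of `F` along the boundary of the rectangle `[a, b] × [c, d]`. -/
noncomputable def rectChange (F : ℝ → ℝ → ℂ) (a b c d : ℝ) : ℂ :=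
  logChange (fun s => F s c) a b + logChange (F b) c d - logChange (fun s => F s d) a b -
    logChange (F a) c d

open Set in
-- A single logarithm exists on the whole rectangle, and its differences along the four sides
-- telescope.
theorem rectChange_eq_zero {F : ℝ → ℝ → ℂ} {a b c d : ℝ}
    (hF : ContinuousOn (Function.uncurry F) (uIcc a b ×ˢ uIcc c d))
    (h0 : ∀ s ∈ uIcc a b, ∀ t ∈ uIcc c d, F s t ≠ 0) : rectChange F a b c d = 0 := by
  obtain ⟨L, hL, h⟩ := exists_log_uIcc_prod hF h0
  have H : ∀ t ∈ uIcc c d, logChange (fun s => F s t) a b = L (b, t) - L (a, t) := fun t ht =>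
    logChange_eq (L := fun s => L (s, t))
      (hL.comp (by fun_prop) (fun s hs => ⟨hs, ht⟩)) fun s hs => h s hs t ht
  have V : ∀ s ∈ uIcc a b, logChange (F s) c d = L (s, d) - L (s, c) := fun s hs =>
    logChange_eq (L := fun t => L (s, t))
      (hL.comp (by fun_prop) (fun t ht => ⟨hs, ht⟩)) fun t ht => h s hs t ht
  rw [rectChange, H _ left_mem_uIcc, H _ right_mem_uIcc, V _ left_mem_uIcc, V _ right_mem_uIcc]
  ring

open Set in
-- The terms of the common side `s = m` cancel whatever their value, so zeros have to be avoided on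
-- the horizontal sides only.
theorem rectChange_add_left {F : ℝ → ℝ → ℂ} {a m b c d : ℝ} (hF : Continuous (Function.uncurry F))
    (ham : a ≤ m) (hmb : m ≤ b) (hc : ∀ s ∈ Icc a b, F s c ≠ 0) (hd : ∀ s ∈ Icc a b, F s d ≠ 0) :
    rectChange F a b c d = rectChange F a m c d + rectChange F m b c d := by
  have H : ∀ t, Continuous fun s => F s t := fun t =>
    hF.comp (f := fun s => (s, t)) (by fun_prop)
  rw [rectChange, ← logChange_add ham hmb (H c).continuousOn hc,
    ← logChange_add ham hmb (H d).continuousOn hd, rectChange, rectChange]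
  ring

open Set in
theorem rectChange_add_right {F : ℝ → ℝ → ℂ} {a b c m d : ℝ}
    (hF : Continuous (Function.uncurry F))
    (hcm : c ≤ m) (hmd : m ≤ d) (ha : ∀ t ∈ Icc c d, F a t ≠ 0) (hb : ∀ t ∈ Icc c d, F b t ≠ 0) :
    rectChange F a b c d = rectChange F a b c m + rectChange F a b m d := by
  have H : ∀ s, Continuous (F s) := fun s => hF.comp (f := fun t => (s, t)) (by fun_prop)
  rw [rectChange, ← logChange_add hcm hmd (H a).continuousOn ha,
    ← logChange_add hcm hmd (H b).continuousOn hb, rectChange, rectChange]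
  ring

open Set in
/-- The change of logarithm along the boundary of a rectangle is invariant under homotopies that do
not vanish over the boundary. -/
theorem rectChange_homotopy {Φ : ℝ → ℝ → ℝ → ℂ} {a b c d : ℝ}
    (hΦ : ContinuousOn (fun z : ℝ × ℝ × ℝ => Φ z.1 z.2.1 z.2.2)
      (uIcc 0 1 ×ˢ uIcc a b ×ˢ uIcc c d))
    (h0 : ∀ τ ∈ uIcc (0 : ℝ) 1, ∀ x ∈ uIcc a b, ∀ y ∈ uIcc c d,
      (x = a ∨ x = b ∨ y = c ∨ y = d) → Φ τ x y ≠ 0) :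
    rectChange (Φ 0) a b c d = rectChange (Φ 1) a b c d := by
  -- The four lateral faces of the prism over the rectangle carry no zeros, so each has degree 0;
  -- their alternating sum is the difference of the two bases.
  have H : ∀ y ∈ uIcc c d, (y = c ∨ y = d) → rectChange (fun x τ => Φ τ x y) a b 0 1 = 0 :=
    fun y hy hy' => rectChange_eq_zero
      (hΦ.comp (f := fun z : ℝ × ℝ => (z.2, z.1, y)) (by fun_prop)
        (fun z hz => ⟨hz.2, hz.1, hy⟩))
      fun x hx τ hτ => h0 τ hτ x hx y hy (Or.inr (Or.inr hy'))
  have V : ∀ x ∈ uIcc a b, (x = a ∨ x = b) → rectChange (fun y τ => Φ τ x y) c d 0 1 = 0 :=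
    fun x hx hx' => rectChange_eq_zero
      (hΦ.comp (f := fun z : ℝ × ℝ => (z.2, x, z.1)) (by fun_prop)
        (fun z hz => ⟨hz.2, hx, hz.1⟩))
      fun y hy τ hτ => h0 τ hτ x hx y hy (hx'.elim Or.inl fun h => Or.inr (Or.inl h))
  have h1 := H c left_mem_uIcc (Or.inl rfl)
  have h2 := H d right_mem_uIcc (Or.inr rfl)
  have h3 := V a left_mem_uIcc (Or.inl rfl)
  have h4 := V b right_mem_uIcc (Or.inr rfl)
  simp only [rectChange] at h1 h2 h3 h4 ⊢
  linear_combination h1 - h2 - h3 + h4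

open Set in
/-- Odd maps have odd degree. -/
theorem exists_odd_rectChange_of_odd {J : ℝ → ℝ → ℂ} {r s : ℝ}
    (hJ : ContinuousOn (Function.uncurry J) (uIcc (-r) r ×ˢ uIcc (-s) s))
    (h0 : ∀ x ∈ uIcc (-r) r, ∀ y ∈ uIcc (-s) s,
      (x = -r ∨ x = r ∨ y = -s ∨ y = s) → J x y ≠ 0)
    (hodd : ∀ x y, J (-x) (-y) = -J x y) :
    ∃ m : ℤ, Odd m ∧ rectChange J (-r) r (-s) s = 2 * Real.pi * Complex.I * m := by
  have Hc : ∀ y ∈ uIcc (-s) s, ContinuousOn (fun x => J x y) (uIcc (-r) r) := fun y hy =>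
    hJ.comp (f := fun x : ℝ => (x, y)) (by fun_prop) fun x hx => ⟨hx, hy⟩
  have Vc : ∀ x ∈ uIcc (-r) r, ContinuousOn (J x) (uIcc (-s) s) := fun x hx =>
    hJ.comp (f := fun y : ℝ => (x, y)) (by fun_prop) fun y hy => ⟨hx, hy⟩
  have H0 : ∀ x ∈ uIcc (-r) r, J x (-s) ≠ 0 := fun x hx => h0 x hx _ left_mem_uIcc (by simp)
  have V0 : ∀ y ∈ uIcc (-s) s, J r y ≠ 0 := fun y hy => h0 _ right_mem_uIcc y hy (by simp)
  have neg_mem : ∀ {r x : ℝ}, x ∈ uIcc (-r) r → -x ∈ uIcc (-r) r := by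
    intro r x hx
    rw [← Set.neg_mem_neg, neg_uIcc, neg_neg, neg_neg, uIcc_comm]
    exact hx
  have hH : logChange (fun x => J x s) (-r) r = -logChange (fun x => J x (-s)) (-r) r := by
    rw [← logChange_symm (Hc _ left_mem_uIcc) H0]
    have h1 := logChange_comp (γ := fun x => J x (-s)) (g := fun x => -x) (a := -r) (b := r)
      (r := -r) (s := r) (by fun_prop) (fun x hx => neg_mem hx) (Hc _ left_mem_uIcc) H0
    rw [neg_neg] at h1
    rw [← h1, ← logChange_neg (γ := fun x => J (-x) (-s))]
    · exact logChange_congr fun x _ => by rw [hodd, neg_neg]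
    · exact (Hc _ left_mem_uIcc).comp (f := fun x : ℝ => -x) (by fun_prop) fun x hx => neg_mem hx
    · exact fun x hx => H0 _ (neg_mem hx)
  have hV : logChange (J (-r)) (-s) s = -logChange (J r) (-s) s := by
    rw [← logChange_symm (Vc _ right_mem_uIcc) V0]
    have h1 := logChange_comp (γ := J r) (g := fun x => -x) (a := -s) (b := s)
      (r := -s) (s := s) (by fun_prop) (fun x hx => neg_mem hx) (Vc _ right_mem_uIcc) V0
    rw [neg_neg] at h1
    rw [← h1, ← logChange_neg (γ := fun x => J r (-x))]
    · exact logChange_congr fun x _ => by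
        have := hodd r (-x)
        rw [neg_neg] at this
        exact this
    · exact (Vc _ right_mem_uIcc).comp (f := fun x : ℝ => -x) (by fun_prop) fun x hx => neg_mem hx
    · exact fun x hx => V0 _ (neg_mem hx)
  have e1 := exp_logChange (Hc _ left_mem_uIcc) H0
  have e2 := exp_logChange (Vc _ right_mem_uIcc) V0
  -- Opposite sides contribute equally, so the total is twice the change along a half boundary from
  -- `(-r, -s)` to `(r, s)`. There `J` changes its sign, so the half change is `πi` plus a multiple
  -- of `2πi`.
  have e3 : Complex.exp (logChange (fun x => J x (-s)) (-r) r + logChange (J r) (-s) s) =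
      Complex.exp (Real.pi * Complex.I) := by
    have n1 := H0 r right_mem_uIcc
    have n2 := V0 s right_mem_uIcc
    rw [Complex.exp_add, e1, e2, hodd, Complex.exp_pi_mul_I]
    field_simp
  obtain ⟨n, hn⟩ := Complex.exp_eq_exp_iff_exists_int.1 e3
  refine ⟨2 * n + 1, ⟨n, rfl⟩, ?_⟩
  rw [rectChange, hH, hV]
  push_cast
  linear_combination 2 * hn

open Set in
/-- The difference of the two axes under an injective map of the plane has odd degree. -/
theorem exists_odd_rectChange_axes {Ψ : ℝ × ℝ → ℂ} {R r s : ℝ}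
    (hc : ContinuousOn Ψ (Icc (-R) R ×ˢ Icc (-R) R)) (hi : InjOn Ψ (Icc (-R) R ×ˢ Icc (-R) R))
    (hr : r ≠ 0) (hs : s ≠ 0) (hrR : |r| ≤ R) (hsR : |s| ≤ R) :
    ∃ m : ℤ, Odd m ∧ rectChange (fun x y => Ψ (x, 0) - Ψ (0, y)) (-r) r (-s) s =
      2 * Real.pi * Complex.I * m := by
  -- The two arguments of `Ψ` always differ by `(x, -y)`, so injectivity excludes zeros other than
  -- `x = y = 0`. At `τ = 1` they are `(x/2, -y/2)` and its negative, which makes `Φ 1` odd.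
  set Φ : ℝ → ℝ → ℝ → ℂ := fun τ x y =>
    Ψ (x - τ * x / 2, -(τ * y / 2)) - Ψ (-(τ * x / 2), y - τ * y / 2) with hΦ
  have hu : ∀ {r x : ℝ}, |r| ≤ R → x ∈ uIcc (-r) r → |x| ≤ R := by
    intro r x hr hx
    rw [uIcc_eq_union] at hx
    rcases hx with hx | hx
    · exact (abs_le.2 hx).trans ((le_abs_self r).trans hr)
    · exact (abs_le.2 (by simpa using hx)).trans ((neg_le_abs r).trans hr)
  have hb : ∀ {τ x : ℝ}, τ ∈ uIcc (0 : ℝ) 1 → |x| ≤ R →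
      x - τ * x / 2 ∈ Icc (-R) R ∧ -(τ * x / 2) ∈ Icc (-R) R := by
    intro τ x hτ hx
    rw [uIcc_of_le zero_le_one] at hτ
    have h1 : |x - τ * x / 2| ≤ |x| := by
      rw [show x - τ * x / 2 = (1 - τ / 2) * x by ring, abs_mul,
        abs_of_nonneg (by linarith [hτ.2])]
      nlinarith [abs_nonneg x, hτ.1]
    have h2 : |-(τ * x / 2)| ≤ |x| := by
      rw [abs_neg, show τ * x / 2 = (τ / 2) * x by ring, abs_mul,
        abs_of_nonneg (by linarith [hτ.1])]
      nlinarith [abs_nonneg x, hτ.2]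
    exact ⟨abs_le.1 (h1.trans hx), abs_le.1 (h2.trans hx)⟩
  have hcΦ : ContinuousOn (fun z : ℝ × ℝ × ℝ => Φ z.1 z.2.1 z.2.2)
      (uIcc 0 1 ×ˢ uIcc (-r) r ×ˢ uIcc (-s) s) := by
    refine ContinuousOn.sub
      (hc.comp (f := fun z : ℝ × ℝ × ℝ => (z.2.1 - z.1 * z.2.1 / 2, -(z.1 * z.2.2 / 2)))
        (by fun_prop) fun z hz => ?_)
      (hc.comp (f := fun z : ℝ × ℝ × ℝ => (-(z.1 * z.2.1 / 2), z.2.2 - z.1 * z.2.2 / 2))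
        (by fun_prop) fun z hz => ?_)
    · exact ⟨(hb hz.1 (hu hrR hz.2.1)).1, (hb hz.1 (hu hsR hz.2.2)).2⟩
    · exact ⟨(hb hz.1 (hu hrR hz.2.1)).2, (hb hz.1 (hu hsR hz.2.2)).1⟩
  have hΦ0 : ∀ τ ∈ uIcc (0 : ℝ) 1, ∀ x ∈ uIcc (-r) r, ∀ y ∈ uIcc (-s) s,
      (x = -r ∨ x = r ∨ y = -s ∨ y = s) → Φ τ x y ≠ 0 := by
    intro τ hτ x hx y hy hxy h
    have := hi ⟨(hb hτ (hu hrR hx)).1, (hb hτ (hu hsR hy)).2⟩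
      ⟨(hb hτ (hu hrR hx)).2, (hb hτ (hu hsR hy)).1⟩ (sub_eq_zero.1 h)
    simp only [Prod.mk.injEq] at this
    have hx0 : x = 0 := by linarith [this.1]
    have hy0 : y = 0 := by linarith [this.2]
    rcases hxy with h | h | h | h
    · exact hr (by linarith)
    · exact hr (by linarith)
    · exact hs (by linarith)
    · exact hs (by linarith)
  have h01 := rectChange_homotopy hcΦ hΦ0
  have hΦzero : Φ 0 = fun x y => Ψ (x, 0) - Ψ (0, y) := by
    funext x y; simp [hΦ]
  rw [← hΦzero, h01]
  have m1 : (1 : ℝ) ∈ uIcc (0 : ℝ) 1 := right_mem_uIcc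
  refine exists_odd_rectChange_of_odd
    (hcΦ.comp (f := fun z : ℝ × ℝ => (1, z.1, z.2)) (by fun_prop)
      fun z hz => ⟨m1, hz.1, hz.2⟩)
    (fun x hx y hy => hΦ0 1 m1 x hx y hy) fun x y => ?_
  simp only [hΦ]
  rw [neg_sub]
  congr 2 <;> ext <;> ring

/-! ### Counting odd zeros in a rectangle. -/

/-- The point `(s, t)` lies in arbitrarily small rectangles on whose boundaries the degree of `F`
is odd. -/
def IsOddZero (F : ℝ → ℝ → ℂ) (s t : ℝ) : Prop :=
  ∀ ε > 0, ∃ s₁ s₂ t₁ t₂, s₁ ∈ Set.Ioo (s - ε) s ∧ s₂ ∈ Set.Ioo s (s + ε) ∧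
    t₁ ∈ Set.Ioo (t - ε) t ∧ t₂ ∈ Set.Ioo t (t + ε) ∧
    ∃ m : ℤ, Odd m ∧ rectChange F s₁ s₂ t₁ t₂ = 2 * Real.pi * Complex.I * m

open Set in
/-- If a rectangle contains exactly one zero, an odd one, the degree on its boundary is odd. -/
theorem exists_rectChange_of_unique {F : ℝ → ℝ → ℂ} (hF : Continuous (Function.uncurry F))
    {a b c d s t : ℝ} (hs : s ∈ Ioo a b) (ht : t ∈ Ioo c d)
    (h0 : ∀ x ∈ Icc a b, ∀ y ∈ Icc c d, F x y = 0 → x = s ∧ y = t) (hodd : IsOddZero F s t) :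
    ∃ m : ℤ, Odd m ∧ rectChange F a b c d = 2 * Real.pi * Complex.I * m := by
  obtain ⟨s₁, s₂, t₁, t₂, hs₁, hs₂, ht₁, ht₂, m, hm, hrect⟩ :=
    hodd (min (min (s - a) (b - s)) (min (t - c) (d - t)))
      (by simp only [gt_iff_lt, lt_min_iff, sub_pos]; exact ⟨hs, ht⟩)
  have m1 := min_le_left (min (s - a) (b - s)) (min (t - c) (d - t))
  have m2 := min_le_right (min (s - a) (b - s)) (min (t - c) (d - t))
  have m3 := min_le_left (s - a) (b - s)
  have m4 := min_le_right (s - a) (b - s)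
  have m5 := min_le_left (t - c) (d - t)
  have m6 := min_le_right (t - c) (d - t)
  have has : a ≤ s₁ := by linarith [hs₁.1]
  have hbs : s₂ ≤ b := by linarith [hs₂.2]
  have hct : c ≤ t₁ := by linarith [ht₁.1]
  have hdt : t₂ ≤ d := by linarith [ht₂.2]
  have l1 := hs₁.2
  have l2 := hs₂.1
  have l3 := ht₁.2
  have l4 := ht₂.1
  obtain ⟨g1, g2⟩ := hs
  obtain ⟨g3, g4⟩ := ht
  have ne : ∀ {x y : ℝ}, a ≤ x → x ≤ b → c ≤ y → y ≤ d → (x ≠ s ∨ y ≠ t) → F x y ≠ 0 := by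
    intro x y h1 h2 h3 h4 h5 h6
    obtain ⟨e1, e2⟩ := h0 x ⟨h1, h2⟩ y ⟨h3, h4⟩ h6
    rcases h5 with h | h
    · exact h e1
    · exact h e2
  have zero : ∀ {x x' y y' : ℝ}, a ≤ x → x ≤ x' → x' ≤ b → c ≤ y → y ≤ y' → y' ≤ d →
      (x' < s ∨ s < x ∨ y' < t ∨ t < y) → rectChange F x x' y y' = 0 := by
    intro x x' y y' h1 h2 h3 h4 h5 h6 h7
    refine rectChange_eq_zero hF.continuousOn ?_
    rw [uIcc_of_le h2, uIcc_of_le h5]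
    intro u hu v hv
    refine ne (h1.trans hu.1) (hu.2.trans h3) (h4.trans hv.1) (hv.2.trans h6) ?_
    rcases h7 with h | h | h | h
    · exact Or.inl (hu.2.trans_lt h).ne
    · exact Or.inl (h.trans_le hu.1).ne'
    · exact Or.inr (hv.2.trans_lt h).ne
    · exact Or.inr (h.trans_le hv.1).ne'
  refine ⟨m, hm, ?_⟩
  -- Cut into a left strip, a right strip, and a middle column of three pieces; only the central
  -- piece contains the zero.
  rw [rectChange_add_left hF (m := s₁) has (by linarith)
      (fun x hx => ne hx.1 hx.2 le_rfl (by linarith) (Or.inr g3.ne))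
      (fun x hx => ne hx.1 hx.2 (by linarith) le_rfl (Or.inr g4.ne')),
    rectChange_add_left hF (a := s₁) (m := s₂) (by linarith) hbs
      (fun x hx => ne (has.trans hx.1) hx.2 le_rfl (by linarith) (Or.inr g3.ne))
      (fun x hx => ne (has.trans hx.1) hx.2 (by linarith) le_rfl (Or.inr g4.ne')),
    rectChange_add_right hF (a := s₁) (b := s₂) (m := t₁) hct (by linarith)
      (fun y hy => ne has (by linarith) hy.1 hy.2 (Or.inl l1.ne))
      (fun y hy => ne (by linarith) hbs hy.1 hy.2 (Or.inl l2.ne')),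
    rectChange_add_right hF (a := s₁) (b := s₂) (c := t₁) (m := t₂) (by linarith) hdt
      (fun y hy => ne has (by linarith) (hct.trans hy.1) hy.2 (Or.inl l1.ne))
      (fun y hy => ne (by linarith) hbs (hct.trans hy.1) hy.2 (Or.inl l2.ne')), hrect,
    zero le_rfl has (by linarith) le_rfl (by linarith) le_rfl (Or.inl l1),
    zero (by linarith) hbs le_rfl le_rfl (by linarith) le_rfl (Or.inr (Or.inl l2)),
    zero has (by linarith) hbs le_rfl hct (by linarith) (Or.inr (Or.inr (Or.inl l3))),
    zero has (by linarith) hbs (by linarith) hdt le_rfl (Or.inr (Or.inr (Or.inr l4)))]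
  ring

open Set in
/-- The degree on the boundary of a rectangle has the parity of the number of zeros inside, if
these are finitely many odd ones, on different vertical lines. -/
theorem exists_rectChange_eq_ncard {F : ℝ → ℝ → ℂ} (hF : Continuous (Function.uncurry F))
    {a b c d : ℝ} (hab : a ≤ b) (hcd : c ≤ d)
    (hfin : {z : ℝ × ℝ | z ∈ Icc a b ×ˢ Icc c d ∧ F z.1 z.2 = 0}.Finite)
    (hint : ∀ x ∈ Icc a b, ∀ y ∈ Icc c d, F x y = 0 →
      x ∈ Ioo a b ∧ y ∈ Ioo c d ∧ IsOddZero F x y)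
    (hinj : ∀ x ∈ Icc a b, ∀ y ∈ Icc c d, ∀ y' ∈ Icc c d, F x y = 0 → F x y' = 0 → y = y') :
    ∃ m : ℤ, rectChange F a b c d = 2 * Real.pi * Complex.I * m ∧
      (m : ZMod 2) = {z : ℝ × ℝ | z ∈ Icc a b ×ˢ Icc c d ∧ F z.1 z.2 = 0}.ncard := by
  induction hn : {z : ℝ × ℝ | z ∈ Icc a b ×ˢ Icc c d ∧ F z.1 z.2 = 0}.ncard
    using Nat.strong_induction_on generalizing a b with
  | _ n ih =>
  set Z := {z : ℝ × ℝ | z ∈ Icc a b ×ˢ Icc c d ∧ F z.1 z.2 = 0} with hZ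
  rcases Z.eq_empty_or_nonempty with hE | ⟨⟨s, t⟩, ⟨hs, ht⟩, hst⟩
  · refine ⟨0, ?_, ?_⟩
    · rw [rectChange_eq_zero hF.continuousOn, Int.cast_zero, mul_zero]
      rw [uIcc_of_le hab, uIcc_of_le hcd]
      exact fun x hx y hy h => (hE.subset (show (x, y) ∈ Z from ⟨⟨hx, hy⟩, h⟩)).elim
    · rw [← hn, hE]; simp
  simp only at hs ht hst
  by_cases huniq : ∀ x ∈ Icc a b, ∀ y ∈ Icc c d, F x y = 0 → x = s ∧ y = t
  · obtain ⟨h1, h2, h3⟩ := hint s hs t ht hst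
    obtain ⟨m, hm, h⟩ := exists_rectChange_of_unique hF h1 h2 huniq h3
    refine ⟨m, h, ?_⟩
    have : Z = {(s, t)} := by
      ext ⟨x, y⟩
      constructor
      · rintro ⟨⟨hx, hy⟩, h⟩
        exact Prod.ext_iff.2 (huniq x hx y hy h)
      · intro h
        rw [mem_singleton_iff] at h
        rw [h]
        exact ⟨⟨hs, ht⟩, hst⟩
    rw [← hn, this, ncard_singleton, Nat.cast_one]
    exact (ZMod.intCast_eq_one_iff_odd).2 hm
  · push Not at huniq
    obtain ⟨s', hs', t', ht', hst', hne⟩ := huniq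
    have hss : s' ≠ s := by
      rintro rfl
      exact hne rfl (hinj _ hs _ ht' _ ht hst' hst)
    clear hne
    wlog hlt : s < s' generalizing s s' t t'
    · exact this s' t' hst' hs' ht' s hs t ht hst hss.symm
        (lt_of_le_of_ne (not_lt.1 hlt) hss)
    -- A vertical line between the two zeros that avoids all zeros. Both halves contain a zero, so
    -- both counts drop.
    obtain ⟨m, ⟨hm1, hm2⟩, hmZ⟩ := (Ioo_infinite hlt).exists_notMem_finite (hfin.image Prod.fst)
    have ham : a ≤ m := hs.1.trans hm1.le
    have hmb : m ≤ b := hm2.le.trans hs'.2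
    have hne : ∀ y ∈ Icc c d, F m y ≠ 0 := fun y hy h =>
      hmZ ⟨(m, y), ⟨⟨⟨ham, hmb⟩, hy⟩, h⟩, rfl⟩
    set Z₁ := {z : ℝ × ℝ | z ∈ Icc a m ×ˢ Icc c d ∧ F z.1 z.2 = 0} with hZ₁
    set Z₂ := {z : ℝ × ℝ | z ∈ Icc m b ×ˢ Icc c d ∧ F z.1 z.2 = 0} with hZ₂
    have hsub₁ : Z₁ ⊆ Z := fun z hz => ⟨⟨⟨hz.1.1.1, hz.1.1.2.trans hmb⟩, hz.1.2⟩, hz.2⟩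
    have hsub₂ : Z₂ ⊆ Z := fun z hz => ⟨⟨⟨ham.trans hz.1.1.1, hz.1.1.2⟩, hz.1.2⟩, hz.2⟩
    have hunion : Z = Z₁ ∪ Z₂ := by
      refine Subset.antisymm (fun z hz => ?_) (union_subset hsub₁ hsub₂)
      rcases le_total z.1 m with h | h
      · exact Or.inl ⟨⟨⟨hz.1.1.1, h⟩, hz.1.2⟩, hz.2⟩
      · exact Or.inr ⟨⟨⟨h, hz.1.1.2⟩, hz.1.2⟩, hz.2⟩
    have hdisj : Disjoint Z₁ Z₂ := by
      rw [Set.disjoint_left]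
      intro z h1 h2
      have : z.1 = m := le_antisymm h1.1.1.2 h2.1.1.1
      exact hne z.2 h1.1.2 (this ▸ h1.2)
    have hf₁ := hfin.subset hsub₁
    have hf₂ := hfin.subset hsub₂
    have hcard : Z.ncard = Z₁.ncard + Z₂.ncard := by
      rw [hunion, ncard_union_eq hdisj hf₁ hf₂]
    have hp₁ : 0 < Z₁.ncard := (ncard_pos hf₁).2 ⟨(s, t), ⟨⟨hs.1, hm1.le⟩, ht⟩, hst⟩
    have hp₂ : 0 < Z₂.ncard := (ncard_pos hf₂).2 ⟨(s', t'), ⟨⟨hm2.le, hs'.2⟩, ht'⟩, hst'⟩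
    obtain ⟨m₁, e₁, p₁⟩ := ih Z₁.ncard (by omega) ham hf₁
      (fun x hx y hy h => by
        obtain ⟨h1, h2, h3⟩ := hint x ⟨hx.1, hx.2.trans hmb⟩ y hy h
        exact ⟨⟨h1.1, lt_of_le_of_ne hx.2 fun e => hne y hy (e ▸ h)⟩, h2, h3⟩)
      (fun x hx => hinj x ⟨hx.1, hx.2.trans hmb⟩) rfl
    obtain ⟨m₂, e₂, p₂⟩ := ih Z₂.ncard (by omega) hmb hf₂
      (fun x hx y hy h => by
        obtain ⟨h1, h2, h3⟩ := hint x ⟨ham.trans hx.1, hx.2⟩ y hy h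
        exact ⟨⟨lt_of_le_of_ne hx.1 fun e => hne y hy (e ▸ h), h1.2⟩, h2, h3⟩)
      (fun x hx => hinj x ⟨ham.trans hx.1, hx.2⟩) rfl
    refine ⟨m₁ + m₂, ?_, ?_⟩
    · rw [rectChange_add_left hF ham hmb
        (fun x hx h => (hint x hx c (left_mem_Icc.2 hcd) h).2.1.1.false)
        (fun x hx h => (hint x hx d (right_mem_Icc.2 hcd) h).2.1.2.false), e₁, e₂]
      push_cast; ring
    · rw [← hn, hcard, Int.cast_add, p₁, p₂, Nat.cast_add]

/-! ### Transversal crossings are odd zeros. -/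

/-- The real function `g` changes its sign at `s`: it takes some opposite nonzero values,
bounded by any given `R`, arbitrarily near on the two sides of `s`. -/
def CrossesZero (g : ℝ → ℝ) (s : ℝ) : Prop :=
  ∀ ε > 0, ∀ R > 0, ∃ r ≠ 0, |r| ≤ R ∧ ∃ s₁ ∈ Set.Ioo (s - ε) s, ∃ s₂ ∈ Set.Ioo s (s + ε),
    ContinuousOn g (Set.Icc s₁ s₂) ∧ (∀ x ∈ Set.Icc s₁ s₂, |g x| ≤ R) ∧ g s₁ = -r ∧ g s₂ = r

open Set in
/-- A continuous real function with an isolated zero at `s` which is open there changes its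
sign. -/
theorem crossesZero_of_nhds_le {g : ℝ → ℝ} {s : ℝ} (hg : ∀ᶠ x in 𝓝 s, ContinuousAt g x)
    (h0 : g s = 0) (hne : ∀ᶠ x in 𝓝 s, g x = 0 → x = s) (hmap : 𝓝 0 ≤ map g (𝓝 s)) :
    CrossesZero g s := by
  intro ε hε R hR
  have hb : ∀ᶠ x in 𝓝 s, |g x| ≤ R := by
    have : Tendsto (fun x => |g x|) (𝓝 s) (𝓝 0) := by
      have := hg.self_of_nhds.abs.tendsto
      rwa [h0, abs_zero] at this
    exact (this.eventually_lt_const hR).mono fun _ => le_of_lt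
  obtain ⟨δ', hδ', hall⟩ := Metric.eventually_nhds_iff_ball.1 (hg.and (hne.and hb))
  set δ := min (δ' / 2) (ε / 2) with hδ
  have hδ0 : 0 < δ := by positivity
  have hδ1 : δ < δ' := (min_le_left _ _).trans_lt (by linarith)
  have hδ2 : δ < ε := (min_le_right _ _).trans_lt (by linarith)
  have hI : ∀ x ∈ Icc (s - δ) (s + δ), ContinuousAt g x ∧ (g x = 0 → x = s) ∧ |g x| ≤ R :=
    fun x hx => hall x (by
      rw [Metric.mem_ball, Real.dist_eq]
      exact (abs_le.2 ⟨by linarith [hx.1], by linarith [hx.2]⟩).trans_lt hδ1)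
  have hc : ContinuousOn g (Icc (s - δ) (s + δ)) := fun x hx => (hI x hx).1.continuousWithinAt
  -- If `g` had the same sign at both ends, openness would give a point `u ≠ s` with a value of the
  -- other sign. Between `u` and the end on its side of `s` there would be a second zero.
  have hopp : ¬ 0 < g (s - δ) * g (s + δ) := by
    intro hpos
    have himg : g '' Icc (s - δ) (s + δ) ∈ 𝓝 (0 : ℝ) :=
      hmap (image_mem_map (Icc_mem_nhds (by linarith) (by linarith)))
    obtain ⟨η, hη, hηs⟩ := Metric.mem_nhds_iff.1 himg
    have mem : ∀ c : ℝ, |c| < η → ∃ u ∈ Icc (s - δ) (s + δ), g u = c := fun c hc =>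
      hηs (by simpa using hc)
    obtain ⟨u, hu, hgu, hgu0⟩ : ∃ u ∈ Icc (s - δ) (s + δ), g u * g (s + δ) < 0 ∧
        g u * g (s - δ) < 0 := by
      rcases lt_or_ge 0 (g (s + δ)) with h | h
      · obtain ⟨u, hu, e⟩ := mem (-(η / 2)) (by rw [abs_neg, abs_of_pos] <;> linarith)
        have h' : 0 < g (s - δ) := pos_of_mul_pos_left hpos h.le
        exact ⟨u, hu, by rw [e]; nlinarith, by rw [e]; nlinarith⟩
      · obtain ⟨u, hu, e⟩ := mem (η / 2) (by rw [abs_of_pos] <;> linarith)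
        have h1 : g (s + δ) < 0 := lt_of_le_of_ne h fun e => by simp [e] at hpos
        have h' : g (s - δ) < 0 := by nlinarith
        exact ⟨u, hu, by rw [e]; nlinarith, by rw [e]; nlinarith⟩
    have zero : ∀ x y, x ∈ Icc (s - δ) (s + δ) → y ∈ Icc (s - δ) (s + δ) → g x * g y < 0 →
        ∃ z ∈ uIcc x y, g z = 0 := by
      intro x y hx hy hxy
      have hsub : uIcc x y ⊆ Icc (s - δ) (s + δ) := by
        rw [← uIcc_of_le (by linarith : s - δ ≤ s + δ)] at hx hy ⊢
        exact uIcc_subset_uIcc hx hy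
      have h0m : (0 : ℝ) ∈ uIcc (g x) (g y) := by
        rw [mem_uIcc]
        rcases mul_neg_iff.1 hxy with h | h
        · exact Or.inr ⟨h.2.le, h.1.le⟩
        · exact Or.inl ⟨h.1.le, h.2.le⟩
      exact intermediate_value_uIcc (hc.mono hsub) h0m
    have hus : u ≠ s := by rintro rfl; simp [h0] at hgu
    rcases lt_or_gt_of_ne hus with h | h
    · obtain ⟨z, hz, hgz⟩ := zero (s - δ) u ⟨le_rfl, by linarith⟩ hu (by linarith)
      rw [uIcc_of_le hu.1] at hz
      have := (hI z ⟨hz.1, by linarith [hz.2]⟩).2.1 hgz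
      linarith [hz.2]
    · obtain ⟨z, hz, hgz⟩ := zero u (s + δ) hu ⟨by linarith, le_rfl⟩ (by linarith)
      rw [uIcc_of_le hu.2] at hz
      have := (hI z ⟨by linarith [hz.1], hz.2⟩).2.1 hgz
      linarith [hz.1]
  have hl0 : g (s - δ) ≠ 0 := fun h => by
    linarith [(hI (s - δ) ⟨le_rfl, by linarith⟩).2.1 h]
  have hr0 : g (s + δ) ≠ 0 := fun h => by
    linarith [(hI (s + δ) ⟨by linarith, le_rfl⟩).2.1 h]
  clear_value δ
  clear hall hmap hne hg hb hδ
  wlog hpos : 0 < g (s + δ) generalizing g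
  · have hneg : g (s + δ) < 0 := lt_of_le_of_ne (not_lt.1 hpos) hr0
    obtain ⟨r, hr, hrR, s₁, h₁, s₂, h₂, hc', hb, e₁, e₂⟩ := this (g := fun x => -g x)
      (by simpa using h0) (fun x hx => ⟨(hI x hx).1.neg, by simpa using (hI x hx).2⟩) hc.neg
      (by simpa using hopp) (by simpa using hl0) (by simpa using hr0) (by simpa using hneg)
    refine ⟨-r, neg_ne_zero.2 hr, by rwa [abs_neg], s₁, h₁, s₂, h₂, ?_, fun x hx => ?_,
      by linarith, by linarith⟩
    · exact hc'.neg.congr fun x _ => (neg_neg (g x)).symm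
    · rw [← abs_neg]; exact hb x hx
  have hneg : g (s - δ) < 0 :=
    lt_of_le_of_ne (not_lt.1 fun h => hopp (mul_pos h hpos)) hl0
  -- The smaller of the two heights, so that both `r` and `-r` are attained, on opposite sides of
  -- `s`.
  set r := min (g (s + δ)) (-g (s - δ)) with hr
  have hr1 : r ≤ g (s + δ) := min_le_left _ _
  have hr2 : r ≤ -g (s - δ) := min_le_right _ _
  have hrpos : 0 < r := lt_min hpos (by linarith)
  obtain ⟨s₂, hs₂, e₂⟩ := intermediate_value_Icc (by linarith : s ≤ s + δ)
    (hc.mono (Icc_subset_Icc_left (by linarith))) (show r ∈ Icc (g s) (g (s + δ)) by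
      rw [h0]; exact ⟨hrpos.le, hr1⟩)
  obtain ⟨s₁, hs₁, e₁⟩ := intermediate_value_Icc (by linarith : s - δ ≤ s)
    (hc.mono (Icc_subset_Icc_right (by linarith))) (show -r ∈ Icc (g (s - δ)) (g s) by
      rw [h0]; exact ⟨by linarith, by linarith⟩)
  have l₁ : s₁ < s := lt_of_le_of_ne hs₁.2 (by rintro rfl; linarith)
  have l₂ : s < s₂ := lt_of_le_of_ne hs₂.1 (by rintro rfl; linarith)
  have hsub : Icc s₁ s₂ ⊆ Icc (s - δ) (s + δ) := Icc_subset_Icc hs₁.1 hs₂.2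
  refine ⟨r, hrpos.ne', ?_, s₁, ⟨by linarith [hs₁.1], l₁⟩, s₂, ⟨l₂, by linarith [hs₂.2]⟩,
    hc.mono hsub, fun x hx => (hI x (hsub hx)).2.2, e₁, e₂⟩
  rw [← e₂]
  exact (hI s₂ (hsub ⟨by linarith, le_rfl⟩)).2.2

open Set in
-- Along each side of a suitable rectangle, `F` is a reparametrization by `g` or `h` of a side of
-- the model `Ψ (x, 0) - Ψ (0, y)` on `[-r, r] × [-q, q]`. Monotonicity of `g` and `h` is not
-- needed: a change of logarithm depends only on the end parameters, as long as the values stay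
-- where the model has no zero.
theorem isOddZero_of_axes {F : ℝ → ℝ → ℂ} {Ψ : ℝ × ℝ → ℂ} {R s t : ℝ} {g h : ℝ → ℝ} (hR : 0 < R)
    (hc : ContinuousOn Ψ (Icc (-R) R ×ˢ Icc (-R) R)) (hi : InjOn Ψ (Icc (-R) R ×ˢ Icc (-R) R))
    (hg : CrossesZero g s) (hh : CrossesZero h t)
    (hF : ∃ δ > 0, ∀ x ∈ Ioo (s - δ) (s + δ), ∀ y ∈ Ioo (t - δ) (t + δ),
      F x y = Ψ (g x, 0) - Ψ (0, h y)) : IsOddZero F s t := by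
  intro ε hε
  obtain ⟨δ, hδ, hFδ⟩ := hF
  obtain ⟨r, hr, hrR, s₁, hs₁, s₂, hs₂, hgc, hgb, eg₁, eg₂⟩ := hg (min ε δ) (lt_min hε hδ) R hR
  obtain ⟨q, hq, hqR, t₁, ht₁, t₂, ht₂, hhc, hhb, eh₁, eh₂⟩ := hh (min ε δ) (lt_min hε hδ) R hR
  have m1 := min_le_left ε δ
  have m2 := min_le_right ε δ
  have ls : s₁ ≤ s₂ := (hs₁.2.trans hs₂.1).le
  have lt : t₁ ≤ t₂ := (ht₁.2.trans ht₂.1).le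
  refine ⟨s₁, s₂, t₁, t₂, ⟨by linarith [hs₁.1], hs₁.2⟩, ⟨hs₂.1, by linarith [hs₂.2]⟩,
    ⟨by linarith [ht₁.1], ht₁.2⟩, ⟨ht₂.1, by linarith [ht₂.2]⟩, ?_⟩
  obtain ⟨m, hm, hrect⟩ := exists_odd_rectChange_axes hc hi hr hq hrR hqR
  refine ⟨m, hm, ?_⟩
  rw [← hrect]
  have hFK : ∀ x ∈ Icc s₁ s₂, ∀ y ∈ Icc t₁ t₂, F x y = Ψ (g x, 0) - Ψ (0, h y) :=
    fun x hx y hy => hFδ x ⟨by linarith [hx.1, hs₁.1], by linarith [hx.2, hs₂.2]⟩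
      y ⟨by linarith [hy.1, ht₁.1], by linarith [hy.2, ht₂.2]⟩
  have hRR : uIcc (-R) R = Icc (-R) R := uIcc_of_le (by linarith)
  have h0R : (0 : ℝ) ∈ Icc (-R) R := ⟨by linarith, hR.le⟩
  have hX : ContinuousOn (fun x : ℝ => Ψ (x, 0)) (Icc (-R) R) :=
    hc.comp (f := fun x : ℝ => (x, (0 : ℝ))) (by fun_prop) fun x hx => ⟨hx, h0R⟩
  have hY : ContinuousOn (fun y : ℝ => Ψ (0, y)) (Icc (-R) R) :=
    hc.comp (f := fun y : ℝ => ((0 : ℝ), y)) (by fun_prop) fun y hy => ⟨h0R, hy⟩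
  have hne : ∀ x ∈ Icc (-R) R, ∀ y ∈ Icc (-R) R, (x ≠ 0 ∨ y ≠ 0) → Ψ (x, 0) - Ψ (0, y) ≠ 0 := by
    intro x hx y hy hxy e
    have := hi (x₁ := (x, 0)) (x₂ := (0, y)) ⟨hx, h0R⟩ ⟨h0R, hy⟩ (sub_eq_zero.1 e)
    simp only [Prod.mk.injEq] at this
    rcases hxy with h | h
    · exact h this.1
    · exact h this.2.symm
  have hgm : ∀ x ∈ Icc s₁ s₂, g x ∈ Icc (-R) R := fun x hx => abs_le.1 (hgb x hx)
  have hhm : ∀ y ∈ Icc t₁ t₂, h y ∈ Icc (-R) R := fun y hy => abs_le.1 (hhb y hy)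
  have H : ∀ y ∈ Icc t₁ t₂, h y ≠ 0 → logChange (fun x => F x y) s₁ s₂ =
      logChange (fun x => Ψ (x, 0) - Ψ (0, h y)) (-r) r := by
    intro y hy hy0
    rw [← eg₁, ← eg₂, ← logChange_comp (γ := fun x => Ψ (x, 0) - Ψ (0, h y)) (g := g)
      (r := -R) (s := R)]
    · rw [← uIcc_of_le ls] at hFK
      exact logChange_congr fun x hx => hFK x hx y hy
    · rwa [uIcc_of_le ls]
    · rwa [uIcc_of_le ls, hRR]
    · rw [hRR]; exact hX.sub continuousOn_const
    · rw [hRR]; exact fun x hx => hne x hx _ (hhm y hy) (Or.inr hy0)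
  have V : ∀ x ∈ Icc s₁ s₂, g x ≠ 0 → logChange (F x) t₁ t₂ =
      logChange (fun y => Ψ (g x, 0) - Ψ (0, y)) (-q) q := by
    intro x hx hx0
    rw [← eh₁, ← eh₂, ← logChange_comp (γ := fun y => Ψ (g x, 0) - Ψ (0, y)) (g := h)
      (r := -R) (s := R)]
    · rw [← uIcc_of_le lt] at hFK
      exact logChange_congr fun y hy => hFK x hx y hy
    · rwa [uIcc_of_le lt]
    · rwa [uIcc_of_le lt, hRR]
    · rw [hRR]; exact continuousOn_const.sub hY
    · rw [hRR]; exact fun y hy => hne _ (hgm x hx) y hy (Or.inl hx0)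
  rw [rectChange, rectChange, H t₁ ⟨le_rfl, lt⟩ (by rw [eh₁]; exact neg_ne_zero.2 hq),
    H t₂ ⟨lt, le_rfl⟩ (by rwa [eh₂]), V s₁ ⟨le_rfl, ls⟩ (by rw [eg₁]; exact neg_ne_zero.2 hr),
    V s₂ ⟨ls, le_rfl⟩ (by rwa [eg₂]), eg₁, eg₂, eh₁, eh₂]

namespace SimpleGraph

theorem CrossTransversally.symm {X : Type*} [TopologicalSpace X]
    {f : X → EuclideanSpace ℝ (Fin 2)} {x y : X} (h : CrossTransversally f x y) :
    CrossTransversally f y x := by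
  obtain ⟨φ, h1, h2, h3, h4, h5⟩ := h
  have key : ∀ {A B : Set (ℝ × ℝ)} {z : X}, Prod.swap ⁻¹' B = A →
      map (fun z => φ (f z)) (𝓝 z) = 𝓝[A] 0 →
      map (fun z => (φ.transHomeomorph (Homeomorph.prodComm ℝ ℝ)) (f z)) (𝓝 z) = 𝓝[B] 0 := by
    intro A B z hAB hz
    have : (fun z => (φ.transHomeomorph (Homeomorph.prodComm ℝ ℝ)) (f z)) =
        (Homeomorph.prodComm ℝ ℝ) ∘ fun z => φ (f z) := rfl
    rw [this, ← Filter.map_map, hz, (Homeomorph.prodComm ℝ ℝ).isEmbedding.map_nhdsWithin_eq]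
    congr 1
    rw [← hAB]
    exact Set.image_preimage_eq _ Prod.swap_surjective
  refine ⟨φ.transHomeomorph (Homeomorph.prodComm ℝ ℝ), ?_, h2.symm, ?_, key ?_ h5, key ?_ h4⟩
  · rw [h2]; simpa using h1
  · rw [h2]
    simp [h3]
  · rfl
  · rfl

/-- The identification of the Euclidean plane with the complex numbers. -/
noncomputable def planeToComplex : EuclideanSpace ℝ (Fin 2) ≃ₗᵢ[ℝ] ℂ :=
  Complex.orthonormalBasisOneI.repr.symm

/-- In the local coordinates `φ` the two branches run in the axes, so `F` has the model form with
`Ψ` given by `φ.symm`. Openness of `D` and `E` at the crossing makes both axis coordinates change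
sign. -/
theorem CrossTransversally.isOddZero {X : Type*} [TopologicalSpace X]
    {f : X → EuclideanSpace ℝ (Fin 2)} (hf : Continuous f) {D E : ℝ → X} (hD : Continuous D)
    (hE : Continuous E) {s t : ℝ} (h : CrossTransversally f (D s) (E t))
    (hDs : 𝓝 (D s) ≤ map D (𝓝 s)) (hEt : 𝓝 (E t) ≤ map E (𝓝 t))
    (hDi : ∀ᶠ x in 𝓝 s, f (D x) = f (D s) → x = s)
    (hEi : ∀ᶠ x in 𝓝 t, f (E x) = f (E t) → x = t) :
    IsOddZero (fun x y => planeToComplex (f (D x)) - planeToComplex (f (E y))) s t := by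
  obtain ⟨φ, hsrc, hfe, hφ0, hx, hy⟩ := h
  have h0t : (0 : ℝ × ℝ) ∈ φ.target := hφ0 ▸ φ.map_source hsrc
  obtain ⟨R, hR, hRt⟩ := Metric.nhds_basis_closedBall.mem_iff.1 (φ.open_target.mem_nhds h0t)
  have hsq : Set.Icc (-R) R ×ˢ Set.Icc (-R) R ⊆ φ.target := by
    have := hRt
    rw [show (0 : ℝ × ℝ) = (0, 0) from rfl, ← closedBall_prod_same, Real.closedBall_eq_Icc] at this
    simpa using this
  -- Both branches at once: `A` is the axis, `p` its coordinate and `i` its inclusion in the plane.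
  have key : ∀ (P : ℝ → X) (u : ℝ) (A : Set (ℝ × ℝ)) (p : ℝ × ℝ → ℝ) (i : ℝ → ℝ × ℝ),
      Continuous P → f (P u) = f (D s) → 𝓝 (P u) ≤ map P (𝓝 u) →
      (∀ᶠ x in 𝓝 u, f (P x) = f (P u) → x = u) → Continuous p → Continuous i →
      (∀ c, p (i c) = c) → (∀ c, i c ∈ A) → (∀ q ∈ A, i (p q) = q) → i 0 = 0 →
      map (fun z => φ (f z)) (𝓝 (P u)) = 𝓝[A] 0 →
      CrossesZero (fun x => p (φ (f (P x)))) u ∧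
        ∀ᶠ x in 𝓝 u, φ.symm (i (p (φ (f (P x))))) = f (P x) := by
    intro P u A p i hP hPu hmap hinj hp hi hpi hiA hip hi0 hA
    have hs : ∀ᶠ x in 𝓝 u, f (P x) ∈ φ.source :=
      (hf.comp hP).continuousAt.eventually_mem (φ.open_source.mem_nhds (by
        simpa [hPu] using hsrc))
    have hax : ∀ᶠ x in 𝓝 u, φ (f (P x)) ∈ A := by
      have : ∀ᶠ z in map (fun z => φ (f z)) (𝓝 (P u)), z ∈ A := by
        rw [hA]; exact self_mem_nhdsWithin
      exact hP.continuousAt.eventually this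
    have hp0 : p 0 = 0 := by rw [← hi0, hpi]
    refine ⟨crossesZero_of_nhds_le ?_ ?_ ?_ ?_, ?_⟩
    · filter_upwards [hs] with x hx
      exact hp.continuousAt.comp
        ((φ.continuousAt hx).comp (f := fun x => f (P x)) (hf.comp hP).continuousAt)
    · rw [hPu, hφ0, hp0]
    · filter_upwards [hs, hax, hinj] with x h1 h2 h3 h4
      refine h3 (φ.injOn h1 (hPu ▸ hsrc) ?_)
      rw [← hip _ h2, h4, hi0, hPu, hφ0]
    · calc 𝓝 (0 : ℝ) = map p (map i (𝓝 0)) := by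
            rw [Filter.map_map, show p ∘ i = id from funext hpi, Filter.map_id]
        _ ≤ map p (𝓝[A] 0) := Filter.map_mono (by
            refine le_inf ?_ ?_
            · have := hi.tendsto 0
              rwa [hi0] at this
            · exact le_principal_iff.2 (Filter.mem_map.2 (Filter.univ_mem' hiA)))
        _ ≤ map p (map (fun z => φ (f z)) (map P (𝓝 u))) := by
            rw [← hA]; exact Filter.map_mono (Filter.map_mono hmap)
        _ = map (fun x => p (φ (f (P x)))) (𝓝 u) := by rw [Filter.map_map, Filter.map_map]; rfl
    · filter_upwards [hs, hax] with x h1 h2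
      rw [hip _ h2, φ.left_inv h1]
  obtain ⟨g1, g2⟩ := key D s _ Prod.fst (fun c => (c, 0)) hD rfl hDs hDi continuous_fst
    (by fun_prop) (fun _ => rfl) (fun _ => rfl) (fun q hq => Prod.ext rfl hq.symm) rfl hx
  obtain ⟨h1, h2⟩ := key E t _ Prod.snd (fun c => (0, c)) hE hfe hEt hEi continuous_snd
    (by fun_prop) (fun _ => rfl) (fun _ => rfl) (fun q hq => Prod.ext hq.symm rfl) rfl hy
  refine isOddZero_of_axes (Ψ := fun q => planeToComplex (φ.symm q)) hR ?_ ?_ g1 h1 ?_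
  · exact planeToComplex.continuous.comp_continuousOn (φ.continuousOn_symm.mono hsq)
  · exact fun a ha b hb e => φ.symm.injOn (hsq ha) (hsq hb) (planeToComplex.injective e)
  · obtain ⟨δ₁, hδ₁, k₁⟩ := Metric.eventually_nhds_iff_ball.1 g2
    obtain ⟨δ₂, hδ₂, k₂⟩ := Metric.eventually_nhds_iff_ball.1 h2
    have m1 := min_le_left δ₁ δ₂
    have m2 := min_le_right δ₁ δ₂
    refine ⟨min δ₁ δ₂, lt_min hδ₁ hδ₂, fun x hx y hy => ?_⟩
    rw [k₁ x (by rw [Real.ball_eq_Ioo]; exact ⟨by linarith [hx.1], by linarith [hx.2]⟩),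
      k₂ y (by rw [Real.ball_eq_Ioo]; exact ⟨by linarith [hy.1], by linarith [hy.2]⟩)]

end SimpleGraph

/-! ### Parametrized edges in the space of a graph. -/

namespace SimpleGraph

section

variable {V : Type*} [Fintype V] {G : SimpleGraph V}

open Classical in
/-- The point of the space of a graph given by a vertex. -/
noncomputable def vertexPoint (G : SimpleGraph V) (v : V) : G.Realization :=
  ⟨Pi.single v 1, single_mem_stdSimplex ℝ v, Or.inl ⟨v, Pi.support_single_subset⟩⟩

theorem vertexPoint_mem (v : V) : G.vertexPoint v ∈ G.vertexPoints :=
  ⟨v, by classical exact Pi.support_single_subset⟩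

/-- The retraction of the line to the unit interval. -/
noncomputable def unitClamp (s : ℝ) : ℝ := max 0 (min 1 s)

theorem continuous_unitClamp : Continuous unitClamp := by
  unfold unitClamp; fun_prop

theorem unitClamp_mem (s : ℝ) : unitClamp s ∈ Set.Icc (0 : ℝ) 1 :=
  ⟨le_max_left _ _, max_le zero_le_one (min_le_left _ _)⟩

theorem unitClamp_of_mem {s : ℝ} (hs : s ∈ Set.Icc (0 : ℝ) 1) : unitClamp s = s := by
  rw [unitClamp, min_eq_right hs.2, max_eq_right hs.1]

open Classical in
/-- The affine parametrization of an edge by the unit interval, constant outside of it. -/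
noncomputable def edgePath {a b : V} (h : G.Adj a b) (s : ℝ) : G.Realization :=
  ⟨fun v => (1 - unitClamp s) * (Pi.single a 1 : V → ℝ) v + unitClamp s * (Pi.single b 1 : V → ℝ) v,
    by
      have := unitClamp_mem s
      exact convex_stdSimplex ℝ V (single_mem_stdSimplex ℝ a) (single_mem_stdSimplex ℝ b)
        (by linarith [this.2]) this.1 (by ring),
    Or.inr ⟨s(a, b), h, fun v hv => by
      by_contra hv'
      simp only [Sym2.coe_mk, Set.mem_insert_iff, Set.mem_singleton_iff, not_or] at hv'
      exact hv (by simp [hv'.1, hv'.2])⟩⟩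

theorem edgePath_apply_left {a b : V} (h : G.Adj a b) (s : ℝ) :
    (edgePath h s).1 a = 1 - unitClamp s := by
  simp [edgePath, h.ne]

theorem edgePath_apply_right {a b : V} (h : G.Adj a b) (s : ℝ) :
    (edgePath h s).1 b = unitClamp s := by
  simp [edgePath, h.ne']

theorem edgePath_apply_of_ne {a b v : V} (h : G.Adj a b) (s : ℝ) (ha : v ≠ a) (hb : v ≠ b) :
    (edgePath h s).1 v = 0 := by
  simp [edgePath, Pi.single_apply, ha, hb]

theorem edgePath_zero {a b : V} (h : G.Adj a b) : edgePath h 0 = G.vertexPoint a := by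
  apply Subtype.ext
  funext v
  simp [edgePath, vertexPoint, unitClamp]

theorem edgePath_one {a b : V} (h : G.Adj a b) : edgePath h 1 = G.vertexPoint b := by
  apply Subtype.ext
  funext v
  simp [edgePath, vertexPoint, unitClamp]

theorem continuous_edgePath {a b : V} (h : G.Adj a b) : Continuous (edgePath h) := by
  have := continuous_unitClamp
  refine Continuous.subtype_mk (continuous_pi fun v => ?_) _
  fun_prop

theorem edgePath_injOn {a b : V} (h : G.Adj a b) : Set.InjOn (edgePath h) (Set.Icc 0 1) := by
  intro s hs t ht hst
  have := congrArg (fun x : G.Realization => x.1 b) hst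
  simpa only [edgePath_apply_right, unitClamp_of_mem hs, unitClamp_of_mem ht] using this

theorem eq_edgePath {a b : V} (h : G.Adj a b) {x : G.Realization}
    (hx : Function.support x.1 ⊆ {a, b}) : x = edgePath h (x.1 b) := by
  have hz : ∀ v, v ≠ a → v ≠ b → x.1 v = 0 := fun v hva hvb => by
    by_contra hv
    rcases hx hv with h | h
    · exact hva h
    · exact hvb h
  have hsum : x.1 a + x.1 b = 1 := by
    classical
    rw [← x.2.1.2, ← Finset.sum_pair h.ne]
    exact Finset.sum_subset (Finset.subset_univ _) fun v _ hv => by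
      simp only [Finset.mem_insert, Finset.mem_singleton, not_or] at hv
      exact hz v hv.1 hv.2
  have hb : x.1 b ∈ Set.Icc (0 : ℝ) 1 := ⟨x.2.1.1 b, by linarith [x.2.1.1 a]⟩
  apply Subtype.ext
  funext v
  by_cases hva : v = a
  · rw [hva, edgePath_apply_left, unitClamp_of_mem hb]; linarith
  by_cases hvb : v = b
  · rw [hvb, edgePath_apply_right, unitClamp_of_mem hb]
  rw [edgePath_apply_of_ne h _ hva hvb, hz v hva hvb]

theorem edgeArc_eq_image {a b : V} (h : G.Adj a b) :
    G.edgeArc s(a, b) = edgePath h '' Set.Icc 0 1 := by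
  ext x
  constructor
  · intro hx
    have hx' : Function.support x.1 ⊆ {a, b} := by simpa [edgeArc] using hx
    exact ⟨x.1 b, mem_Icc_of_mem_stdSimplex x.2.1 b, (eq_edgePath h hx').symm⟩
  · rintro ⟨s, -, rfl⟩
    intro v hv
    by_contra hv'
    simp only [Sym2.coe_mk, Set.mem_insert_iff, Set.mem_singleton_iff, not_or] at hv'
    exact hv (edgePath_apply_of_ne h s hv'.1 hv'.2)

theorem mem_Ioo_of_edgePath_notMem {a b : V} (h : G.Adj a b) {s : ℝ} (hs : s ∈ Set.Icc (0 : ℝ) 1)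
    (hv : edgePath h s ∉ G.vertexPoints) : s ∈ Set.Ioo (0 : ℝ) 1 := by
  refine ⟨lt_of_le_of_ne hs.1 ?_, lt_of_le_of_ne hs.2 ?_⟩
  · rintro rfl
    exact hv (edgePath_zero h ▸ vertexPoint_mem a)
  · rintro rfl
    exact hv (edgePath_one h ▸ vertexPoint_mem b)

theorem edgePath_ne_vertexPoint {a b p : V} (h : G.Adj a b) (hpa : p ≠ a) (hpb : p ≠ b) (s : ℝ) :
    edgePath h s ≠ G.vertexPoint p := by
  intro e
  have := congrArg (fun x : G.Realization => x.1 p) e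
  simp [edgePath_apply_of_ne h s hpa hpb, vertexPoint] at this

theorem edgePath_ne_edgePath {a b p q : V} (h : G.Adj a b) (h' : G.Adj p q) (hap : a ≠ p)
    (haq : a ≠ q) (hbp : b ≠ p) (hbq : b ≠ q) (s t : ℝ) : edgePath h s ≠ edgePath h' t := by
  intro e
  have h1 := congrArg (fun x : G.Realization => x.1 a) e
  have h2 := congrArg (fun x : G.Realization => x.1 b) e
  simp only [edgePath_apply_left, edgePath_apply_right, edgePath_apply_of_ne h' t hap haq,
    edgePath_apply_of_ne h' t hbp hbq] at h1 h2
  linarith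

/-- Near an interior point of the edge the coordinates at `a` and `b` are both positive. This forces
a point onto this edge, where the coordinate at `b` is a continuous inverse of the parametrization.
-/
theorem nhds_edgePath_le {a b : V} (h : G.Adj a b) {s : ℝ} (hs : s ∈ Set.Ioo (0 : ℝ) 1) :
    𝓝 (edgePath h s) ≤ map (edgePath h) (𝓝 s) := by
  have hcoord : ∀ v, Continuous fun x : G.Realization => x.1 v := fun v =>
    (continuous_apply v).comp continuous_subtype_val
  have hcl := unitClamp_of_mem (Set.Ioo_subset_Icc_self hs)
  have ha : ∀ᶠ x in 𝓝 (edgePath h s), 0 < x.1 a :=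
    (hcoord a).continuousAt.eventually_const_lt
      (by change 0 < (edgePath h s).1 a; rw [edgePath_apply_left, hcl]; linarith [hs.2])
  have hb : ∀ᶠ x in 𝓝 (edgePath h s), 0 < x.1 b :=
    (hcoord b).continuousAt.eventually_const_lt
      (by change 0 < (edgePath h s).1 b; rw [edgePath_apply_right, hcl]; linarith [hs.1])
  have heq : ∀ᶠ x in 𝓝 (edgePath h s), x = edgePath h (x.1 b) := by
    filter_upwards [ha, hb] with x hxa hxb
    refine eq_edgePath h ?_
    rcases x.2.2 with ⟨v, hv⟩ | ⟨e, -, hxe⟩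
    · have h1 : a = v := hv hxa.ne'
      have h2 : b = v := hv hxb.ne'
      exact absurd (h1.trans h2.symm) h.ne
    · have h1 : a ∈ e := hxe hxa.ne'
      have h2 : b ∈ e := hxe hxb.ne'
      have := (Sym2.mem_and_mem_iff h.ne).1 ⟨h1, h2⟩
      rw [this] at hxe
      simpa using hxe
  have htend : Tendsto (fun x : G.Realization => x.1 b) (𝓝 (edgePath h s)) (𝓝 s) := by
    have := (hcoord b).tendsto (edgePath h s)
    rwa [edgePath_apply_right, hcl] at this
  calc 𝓝 (edgePath h s) = map (fun x => edgePath h (x.1 b)) (𝓝 (edgePath h s)) := by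
        conv_lhs => rw [← Filter.map_id (f := 𝓝 (edgePath h s))]
        exact Filter.map_congr heq
    _ = map (edgePath h) (map (fun x : G.Realization => x.1 b) (𝓝 (edgePath h s))) := by
        rw [Filter.map_map]; rfl
    _ ≤ map (edgePath h) (𝓝 s) := Filter.map_mono htend

/-! ### Crossing numbers of disjoint edges of a generic immersion. -/

variable {f : G.Realization → EuclideanSpace ℝ (Fin 2)}

/-- The fibre has exactly two points, so the pair provided by `transversal_double` is the given one
up to order, and transversality is symmetric. -/
theorem IsPlaneGenericImmersion.transversal (hf : G.IsPlaneGenericImmersion f)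
    {x y : G.Realization} (hxy : x ≠ y) (h : f x = f y) :
    f x ∈ multiplePoints f ∧ f ⁻¹' {f x} = {x, y} ∧ x ∉ G.vertexPoints ∧ y ∉ G.vertexPoints ∧
      CrossTransversally f x y := by
  have hm : f x ∈ multiplePoints f := ⟨x, rfl, y, h.symm, hxy⟩
  obtain ⟨x', y', hne, hpre, hx', hy', hc⟩ := hf.transversal_double _ hm
  have h1 : x ∈ ({x', y'} : Set _) := hpre ▸ (rfl : f x = f x)
  have h2 : y ∈ ({x', y'} : Set _) := hpre ▸ (h.symm : f y = f x)
  refine ⟨hm, ?_⟩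
  rcases h1 with rfl | h1 <;> rcases h2 with rfl | h2
  · exact absurd rfl hxy
  · obtain rfl : y = y' := h2
    exact ⟨hpre, hx', hy', hc⟩
  · obtain rfl : x = y' := h1
    exact ⟨hpre.trans (Set.pair_comm _ _), hy', hx', hc.symm⟩
  · obtain rfl : x = y' := h1
    exact absurd h2.symm hxy

/-- The number of crossings of two disjoint edges has the parity of the degree of the difference of
their parametrizations. -/
theorem IsPlaneGenericImmersion.exists_rectChange (hf : G.IsPlaneGenericImmersion f)
    {a b p q : V} (h : G.Adj a b) (h' : G.Adj p q) (hap : a ≠ p)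
    (haq : a ≠ q) (hbp : b ≠ p) (hbq : b ≠ q) :
    ∃ m : ℤ, rectChange (fun s t => planeToComplex (f (edgePath h s)) -
        planeToComplex (f (edgePath h' t))) 0 1 0 1 = 2 * Real.pi * Complex.I * m ∧
      (m : ZMod 2) = G.crossingNumber f s(s(a, b), s(p, q)) := by
  set F : ℝ → ℝ → ℂ := fun s t => planeToComplex (f (edgePath h s)) -
        planeToComplex (f (edgePath h' t)) with hFdef
  have hc := hf.continuous
  have hP := continuous_edgePath h
  have hQ := continuous_edgePath h'
  have hκ := planeToComplex.continuous
  have hF : Continuous (Function.uncurry F) := by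
    simp only [hFdef, Function.uncurry_def]
    fun_prop
  have hdisj := edgePath_ne_edgePath h h' hap haq hbp hbq
  have hz : ∀ {s t}, F s t = 0 → f (edgePath h s) = f (edgePath h' t) := fun e =>
    planeToComplex.injective (sub_eq_zero.1 e)
  have hfib : ∀ {s t}, F s t = 0 → ∀ {x}, f x = f (edgePath h s) →
      x = edgePath h s ∨ x = edgePath h' t := fun {s t} e {x} hx => by
    have := (hf.transversal (hdisj s t) (hz e)).2.1
    exact (this ▸ (show x ∈ f ⁻¹' {f (edgePath h s)} from hx) : x ∈ ({_, _} : Set _))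
  have hS : ∀ {s t s'}, F s t = 0 → s ∈ Set.Icc (0 : ℝ) 1 → s' ∈ Set.Icc (0 : ℝ) 1 →
      f (edgePath h s') = f (edgePath h s) → s' = s := fun {s t s'} e hs hs' hss =>
    edgePath_injOn h hs' hs ((hfib e hss).resolve_right (hdisj s' t))
  have hT : ∀ {s t t'}, F s t = 0 → t ∈ Set.Icc (0 : ℝ) 1 → t' ∈ Set.Icc (0 : ℝ) 1 →
      f (edgePath h' t') = f (edgePath h' t) → t' = t := fun {s t t'} e ht ht' htt =>
    edgePath_injOn h' ht' ht
      ((hfib e (htt.trans (hz e).symm)).resolve_left fun e' => hdisj s t' e'.symm)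
  set Z := {z : ℝ × ℝ | z ∈ Set.Icc (0 : ℝ) 1 ×ˢ Set.Icc (0 : ℝ) 1 ∧ F z.1 z.2 = 0} with hZ
  -- A double point common to two disjoint edges has one preimage on each of them, so zeros of `F`
  -- correspond to crossing points bijectively.
  have hinjZ : Set.InjOn (fun z : ℝ × ℝ => f (edgePath h z.1)) Z := by
    rintro ⟨s, t⟩ ⟨⟨hs, ht⟩, e⟩ ⟨s', t'⟩ ⟨⟨hs', ht'⟩, e'⟩ hss
    simp only at hs ht e hs' ht' e' hss
    obtain rfl := hS e hs hs' hss.symm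
    rw [hT e ht ht' ((hz e').symm.trans (hz e))]
  have himg : (fun z : ℝ × ℝ => f (edgePath h z.1)) '' Z =
      f '' G.edgeArc s(a, b) ∩ f '' G.edgeArc s(p, q) := by
    rw [edgeArc_eq_image h, edgeArc_eq_image h']
    ext w
    constructor
    · rintro ⟨⟨s, t⟩, ⟨⟨hs, ht⟩, e⟩, rfl⟩
      exact ⟨⟨_, ⟨s, hs, rfl⟩, rfl⟩, ⟨_, ⟨t, ht, rfl⟩, (hz e).symm⟩⟩
    · rintro ⟨⟨_, ⟨s, hs, rfl⟩, rfl⟩, ⟨_, ⟨t, ht, rfl⟩, e⟩⟩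
      exact ⟨(s, t), ⟨⟨hs, ht⟩, by simp [hFdef, e]⟩, rfl⟩
  have hfin : Z.Finite := by
    refine Set.Finite.of_finite_image (hf.finite_multiplePoints.subset ?_) hinjZ
    rintro _ ⟨⟨s, t⟩, ⟨-, e⟩, rfl⟩
    exact (hf.transversal (hdisj s t) (hz e)).1
  obtain ⟨m, hm, hmZ⟩ := exists_rectChange_eq_ncard hF zero_le_one zero_le_one hfin
    (fun s hs t ht e => by
      obtain ⟨-, -, hvs, hvt, hcr⟩ := hf.transversal (hdisj s t) (hz e)
      have hs' := mem_Ioo_of_edgePath_notMem h hs hvs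
      have ht' := mem_Ioo_of_edgePath_notMem h' ht hvt
      refine ⟨hs', ht', hcr.isOddZero hc hP hQ (nhds_edgePath_le h hs') (nhds_edgePath_le h' ht')
        ?_ ?_⟩
      · filter_upwards [Icc_mem_nhds hs'.1 hs'.2] with x hx hx'
        exact hS e hs hx hx'
      · filter_upwards [Icc_mem_nhds ht'.1 ht'.2] with x hx hx'
        exact hT e ht hx hx')
    (fun s hs t ht t' ht' e e' => hT e' ht' ht ((hz e).symm.trans (hz e')))
  refine ⟨m, hm, hmZ.trans ?_⟩
  rw [← hinjZ.ncard_image, himg]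
  rfl

/-- The parities of the crossing numbers of disjoint edges are those of a drawing with the vertices
on a convex curve, in the order given by `r`, up to a coboundary. -/
theorem IsPlaneGenericImmersion.exists_crossingNumber_eq (hf : G.IsPlaneGenericImmersion f)
    {r : V → ℕ} (hr : Function.Injective r) : ∃ n : V → V → V → ZMod 2, ∀ a b p q,
      G.Adj a b → G.Adj p q → a ≠ p → a ≠ q → b ≠ p → b ≠ q →
      (G.crossingNumber f s(s(a, b), s(p, q)) : ZMod 2) =
        n a b p + n a b q + (n p q a + n p q b) +
          ((if r p < r b then 1 else 0) + (if r p < r a then 1 else 0) +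
            (if r q < r b then 1 else 0) + (if r q < r a then 1 else 0)) := by
  set z : G.Realization → ℂ := fun x => planeToComplex (f x) with hz
  have hzc : Continuous z := planeToComplex.continuous.comp hf.continuous
  set w : V → ℂ := fun v => z (G.vertexPoint v) with hw
  have hzw : ∀ {x v}, x ≠ G.vertexPoint v → z x ≠ w v := fun hne e =>
    (hf.transversal hne (planeToComplex.injective e)).2.2.2.1 (vertexPoint_mem _)
  have hww : ∀ {u v : V}, u ≠ v → w u ≠ w v := fun {u v} huv => hzw fun e => by
    have := congrArg (fun x : G.Realization => x.1 u) e
    simp [vertexPoint, huv] at this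
  -- Logarithms of `w y - w x` such that `ℓ x y` and `ℓ y x` differ by `±πi`, with the sign
  -- prescribed by the order `r`.
  set ℓ : V → V → ℂ := fun x y => if r x < r y then Complex.log (w y - w x) else
    Complex.log (w x - w y) + Real.pi * Complex.I with hℓ
  have hexp : ∀ x y, x ≠ y → Complex.exp (ℓ x y) = w y - w x := by
    intro x y hxy
    simp only [hℓ]
    split_ifs
    · exact Complex.exp_log (sub_ne_zero.2 (hww hxy.symm))
    · rw [Complex.exp_add, Complex.exp_log (sub_ne_zero.2 (hww hxy)), Complex.exp_pi_mul_I]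
      ring
  set c : V → V → ℤ := fun x y => if r x < r y then 1 else 0 with hcdef
  have hδ : ∀ x y, x ≠ y → ℓ x y - ℓ y x = Real.pi * Complex.I * (1 - 2 * c x y) := by
    intro x y hxy
    simp only [hℓ, hcdef]
    rcases lt_or_gt_of_ne (hr.ne hxy) with h | h
    · rw [if_pos h, if_neg h.not_gt, if_pos h]; push_cast; ring
    · rw [if_neg h.not_gt, if_pos h, if_neg h.not_gt]; push_cast; ring
  have hcont : ∀ {a b : V} (h : G.Adj a b) (v : V), Continuous fun s => z (edgePath h s) - w v :=
    fun h v => (hzc.comp (continuous_edgePath h)).sub continuous_const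
  have hne : ∀ {a b v : V} (h : G.Adj a b), v ≠ a → v ≠ b → ∀ s, z (edgePath h s) - w v ≠ 0 :=
    fun h ha hb s => sub_ne_zero.2 (hzw (edgePath_ne_vertexPoint h ha hb s))
  -- The integer is the winding of the edge `ab` around `v` relative to `ℓ`; it is 0 by default
  -- where this makes no sense.
  have hn : ∀ a b v, ∃ k : ℤ, ∀ h : G.Adj a b, v ≠ a → v ≠ b →
      logChange (fun s => z (edgePath h s) - w v) 0 1 =
        ℓ v b - ℓ v a + k * (2 * Real.pi * Complex.I) := by
    intro a b v
    by_cases H : ∃ _ : G.Adj a b, v ≠ a ∧ v ≠ b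
    · obtain ⟨h, ha, hb⟩ := H
      have := exp_logChange (a := 0) (b := 1) (hcont h v).continuousOn
        fun s _ => hne h ha hb s
      rw [edgePath_zero, edgePath_one, ← hexp v b hb, ← hexp v a ha, ← Complex.exp_sub] at this
      obtain ⟨k, hk⟩ := Complex.exp_eq_exp_iff_exists_int.1 this
      exact ⟨k, fun _ _ _ => hk⟩
    · exact ⟨0, fun h ha hb => absurd ⟨h, ha, hb⟩ H⟩
  choose n hn using hn
  refine ⟨fun a b v => n a b v, fun a b p q h h' hap haq hbp hbq => ?_⟩
  obtain ⟨m, hm, hmZ⟩ := hf.exists_rectChange h h' hap haq hbp hbq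
  have V : ∀ v, v ≠ p → v ≠ q → logChange (fun t => w v - z (edgePath h' t)) 0 1 =
      logChange (fun t => z (edgePath h' t) - w v) 0 1 := fun v hvp hvq => by
    rw [← logChange_neg (hcont h' v).continuousOn fun s _ => hne h' hvp hvq s]
    simp only [neg_sub]
  -- Each end of one edge and each end of the other contribute both `ℓ x y` and `ℓ y x`, with
  -- opposite signs. By `hδ` only the comparisons `c` survive; mod 2 their sum is 1 exactly when `a,
  -- b` and `p, q` interleave.
  have hm' : (m : ℂ) = n a b p + n p q b - n a b q - n p q a -
      (c p b - c p a - c q b + c q a) := by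
    have e : logChange (fun s => z (edgePath h s) - z (edgePath h' 0)) 0 1 +
        logChange (fun t => z (edgePath h 1) - z (edgePath h' t)) 0 1 -
        logChange (fun s => z (edgePath h s) - z (edgePath h' 1)) 0 1 -
        logChange (fun t => z (edgePath h 0) - z (edgePath h' t)) 0 1 =
          2 * Real.pi * Complex.I * m := hm
    rw [edgePath_zero, edgePath_one, edgePath_zero, edgePath_one] at e
    have e' := V a hap haq
    have e'' := V b hbp hbq
    simp only [hw] at e' e'' hn
    rw [e', e'', hn _ _ _ h hap.symm hbp.symm, hn _ _ _ h haq.symm hbq.symm,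
      hn _ _ _ h' hap haq, hn _ _ _ h' hbp hbq] at e
    refine mul_left_cancel₀ Complex.two_pi_I_ne_zero ?_
    linear_combination -e + hδ p b hbp.symm - hδ p a hap.symm - hδ q b hbq.symm + hδ q a haq.symm
  have hm'' : m = n a b p + n p q b - n a b q - n p q a - (c p b - c p a - c q b + c q a) := by
    exact_mod_cast hm'
  rw [← hmZ, hm'']
  simp only [hcdef]
  push_cast
  simp only [CharTwo.sub_eq_add]
  ring

end

end SimpleGraph

/-! ### Combinatorics of the Heawood graph. -/

namespace SimpleGraph

/-- The differences between the indices of the ends of an edge of the Heawood graph. -/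
def heawoodShift : Fin 3 → ZMod 7 := ![0, -1, 2]

/-- The index of the end `v j` of the `x.2`-th edge at the vertex `u x.1` of the Heawood graph. -/
def heawoodEnd (x : ZMod 7 × Fin 3) : ZMod 7 := x.1 + heawoodShift x.2

/-- The `x.2`-th edge at the vertex `u x.1` of the Heawood graph. -/
def heawoodEdge (x : ZMod 7 × Fin 3) : Sym2 (ZMod 7 ⊕ ZMod 7) :=
  s(Sum.inl x.1, Sum.inr (heawoodEnd x))

theorem heawoodGraph_adj_iff {i j : ZMod 7} :
    heawoodGraph.Adj (Sum.inl i) (Sum.inr j) ↔ ∃ k, j = i + heawoodShift k := by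
  simp [heawoodGraph, heawoodShift, Fin.exists_fin_succ, sub_eq_add_neg]

theorem not_heawoodGraph_adj_inl {i j : ZMod 7} :
    ¬ heawoodGraph.Adj (Sum.inl i) (Sum.inl j) := by
  simp [heawoodGraph]

theorem not_heawoodGraph_adj_inr {i j : ZMod 7} :
    ¬ heawoodGraph.Adj (Sum.inr i) (Sum.inr j) := by
  simp [heawoodGraph]

theorem heawoodGraph_adj (x : ZMod 7 × Fin 3) :
    heawoodGraph.Adj (Sum.inl x.1) (Sum.inr (heawoodEnd x)) :=
  heawoodGraph_adj_iff.2 ⟨x.2, rfl⟩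

theorem mem_edgeSet_heawoodGraph {d : Sym2 (ZMod 7 ⊕ ZMod 7)} :
    d ∈ heawoodGraph.edgeSet ↔ ∃ x, d = heawoodEdge x := by
  have key : ∀ {i j}, heawoodGraph.Adj (Sum.inl i) (Sum.inr j) →
      ∃ x, s(Sum.inl i, Sum.inr j) = heawoodEdge x := fun h => by
    obtain ⟨k, rfl⟩ := heawoodGraph_adj_iff.1 h
    exact ⟨(_, k), rfl⟩
  constructor
  · induction d with
    | _ a b =>
    intro h
    rw [mem_edgeSet] at h
    rcases a with i | i <;> rcases b with j | j
    · exact absurd h not_heawoodGraph_adj_inl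
    · exact key h
    · rw [Sym2.eq_swap]; exact key h.symm
    · exact absurd h not_heawoodGraph_adj_inr
  · rintro ⟨x, rfl⟩
    exact heawoodGraph_adj x

theorem heawoodEdge_injective : Function.Injective heawoodEdge := by
  have key : ∀ x y : ZMod 7 × Fin 3, x.1 = y.1 → heawoodEnd x = heawoodEnd y → x = y := by
    decide +kernel
  intro x y h
  simp only [heawoodEdge, Sym2.eq_iff, Sum.inl.injEq, Sum.inr.injEq, reduceCtorEq, and_self,
    or_false] at h
  exact key x y h.1 h.2

/-- The edges `x` and `y` of the Heawood graph have distance at least two. -/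
def HeawoodFar (x y : ZMod 7 × Fin 3) : Prop :=
  x.1 ≠ y.1 ∧ heawoodEnd x ≠ heawoodEnd y ∧ (∀ k, heawoodEnd y ≠ x.1 + heawoodShift k) ∧
    ∀ k, heawoodEnd x ≠ y.1 + heawoodShift k

instance : DecidableRel HeawoodFar := fun _ _ => inferInstanceAs (Decidable (_ ∧ _))

theorem HeawoodFar.symm {x y : ZMod 7 × Fin 3} (h : HeawoodFar x y) : HeawoodFar y x :=
  ⟨h.1.symm, h.2.1.symm, h.2.2.2, h.2.2.1⟩

/-- Any two vertices `u i`, `u j` have a common neighbour, so no two edges have distance above two.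
It remains to exclude common ends and adjacent ends. -/
theorem edgeDist_heawoodEdge {x y : ZMod 7 × Fin 3} :
    heawoodGraph.edgeDist (heawoodEdge x) (heawoodEdge y) = (2 : ℕ) ↔ HeawoodFar x y := by
  have hle : ∀ {u v}, u ∈ heawoodEdge x → v ∈ heawoodEdge y →
      heawoodGraph.edgeDist (heawoodEdge x) (heawoodEdge y) ≤ heawoodGraph.edist u v :=
    fun hu hv => iInf₂_le_of_le _ hu (iInf₂_le _ hv)
  have hxl : Sum.inl x.1 ∈ heawoodEdge x := Sym2.mem_mk_left _ _
  have hxr : Sum.inr (heawoodEnd x) ∈ heawoodEdge x := Sym2.mem_mk_right _ _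
  have hyl : Sum.inl y.1 ∈ heawoodEdge y := Sym2.mem_mk_left _ _
  have hyr : Sum.inr (heawoodEnd y) ∈ heawoodEdge y := Sym2.mem_mk_right _ _
  constructor
  · intro h
    have hnot : ∀ {u v}, u ∈ heawoodEdge x → v ∈ heawoodEdge y →
        ¬ heawoodGraph.Adj u v ∧ u ≠ v := by
      intro u v hu hv
      rw [← not_or, ← edist_le_one_iff_adj_or_eq]
      intro h1
      have := (hle hu hv).trans h1
      rw [h] at this
      exact absurd this (by norm_num)
    refine ⟨fun e => (hnot hxl hyl).2 (by rw [e]), fun e => (hnot hxr hyr).2 (by rw [e]),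
      fun k e => (hnot hxl hyr).1 (heawoodGraph_adj_iff.2 ⟨k, e⟩),
      fun k e => (hnot hxr hyl).1 (heawoodGraph_adj_iff.2 ⟨k, e⟩).symm⟩
  · rintro ⟨h1, h2, h3, h4⟩
    refine le_antisymm ?_ ?_
    · have hcommon : ∀ i j : ZMod 7, ∃ k l, i + heawoodShift k = j + heawoodShift l := by
        decide +kernel
      obtain ⟨k, l, hkl⟩ := hcommon x.1 y.1
      exact (hle hxl hyl).trans (edist_le (Walk.cons (heawoodGraph_adj_iff.2 ⟨k, rfl⟩)
        (Walk.cons (heawoodGraph_adj_iff.2 ⟨l, hkl⟩).symm Walk.nil)))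
    · have hge : ∀ u v, ¬ heawoodGraph.Adj u v → u ≠ v → ((2 : ℕ) : ℕ∞) ≤ heawoodGraph.edist u v := by
        intro u v ha hne
        have : ¬ heawoodGraph.edist u v ≤ 1 := by
          rw [edist_le_one_iff_adj_or_eq, not_or]; exact ⟨ha, hne⟩
        exact Order.add_one_le_of_lt (not_le.1 this)
      refine le_iInf₂ fun u hu => le_iInf₂ fun v hv => ?_
      rcases Sym2.mem_iff.1 hu with rfl | rfl <;> rcases Sym2.mem_iff.1 hv with rfl | rfl
      · exact hge _ _ not_heawoodGraph_adj_inl (by simpa using h1)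
      · refine hge _ _ (fun h => ?_) (by simp)
        obtain ⟨k, hk⟩ := heawoodGraph_adj_iff.1 h
        exact h3 k hk
      · refine hge _ _ (fun h => ?_) (by simp)
        obtain ⟨k, hk⟩ := heawoodGraph_adj_iff.1 h.symm
        exact h4 k hk
      · exact hge _ _ not_heawoodGraph_adj_inr (by simpa using h2)

/-- A strict total order on the edges of the Heawood graph. -/
def heawoodIndex (x : ZMod 7 × Fin 3) : ℕ := 3 * x.1.val + x.2.val

theorem heawoodIndex_injective : Function.Injective heawoodIndex := by
  intro x y h
  have hx := x.2.isLt
  have hy := y.2.isLt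
  simp only [heawoodIndex] at h
  exact Prod.ext (ZMod.val_injective 7 (by omega)) (Fin.ext (by omega))

/-- The pairs of edges of the Heawood graph at distance two, each listed once. -/
def heawoodFarPairs : Finset ((ZMod 7 × Fin 3) × (ZMod 7 × Fin 3)) :=
  Finset.univ.filter fun z => HeawoodFar z.1 z.2 ∧ heawoodIndex z.1 < heawoodIndex z.2

theorem mem_edgePairsAtDist {V : Type*} [Fintype V] {G : SimpleGraph V} {k : ℕ}
    {P : Sym2 (Sym2 V)} : P ∈ G.edgePairsAtDist k ↔
      ∃ d ∈ G.edgeSet, ∃ e ∈ G.edgeSet, P = s(d, e) ∧ G.edgeDist d e = k := by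
  classical exact Finset.mem_filter_univ _

theorem sum_edgePairsAtDist_heawoodGraph {M : Type*} [AddCommMonoid M]
    (c : Sym2 (Sym2 (ZMod 7 ⊕ ZMod 7)) → M) :
    ∑ P ∈ heawoodGraph.edgePairsAtDist 2, c P =
      ∑ z ∈ heawoodFarPairs, c s(heawoodEdge z.1, heawoodEdge z.2) := by
  symm
  refine Finset.sum_bij (fun z _ => s(heawoodEdge z.1, heawoodEdge z.2)) ?_ ?_ ?_ fun _ _ => rfl
  · intro z hz
    rw [heawoodFarPairs, Finset.mem_filter] at hz
    exact mem_edgePairsAtDist.2 ⟨_, mem_edgeSet_heawoodGraph.2 ⟨_, rfl⟩, _,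
      mem_edgeSet_heawoodGraph.2 ⟨_, rfl⟩, rfl, edgeDist_heawoodEdge.2 hz.2.1⟩
  · rintro ⟨x, y⟩ hz ⟨x', y'⟩ hz' h
    simp only [heawoodFarPairs, Finset.mem_filter] at hz hz'
    rcases Sym2.eq_iff.1 h with ⟨h1, h2⟩ | ⟨h1, h2⟩
    · exact Prod.ext (heawoodEdge_injective h1) (heawoodEdge_injective h2)
    · obtain rfl := heawoodEdge_injective h1
      obtain rfl := heawoodEdge_injective h2
      exact absurd hz.2.2 hz'.2.2.not_gt
  · intro P hP
    obtain ⟨d, hd, e, he, rfl, hde⟩ := mem_edgePairsAtDist.1 hP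
    obtain ⟨x, rfl⟩ := mem_edgeSet_heawoodGraph.1 hd
    obtain ⟨y, rfl⟩ := mem_edgeSet_heawoodGraph.1 he
    have hR := edgeDist_heawoodEdge.1 hde
    have hne : heawoodIndex x ≠ heawoodIndex y := fun h =>
      hR.1 (by rw [heawoodIndex_injective h])
    rcases lt_or_gt_of_ne hne with h | h
    · exact ⟨(x, y), Finset.mem_filter.2 ⟨Finset.mem_univ _, hR, h⟩, rfl⟩
    · exact ⟨(y, x), Finset.mem_filter.2 ⟨Finset.mem_univ _, hR.symm, h⟩, Sym2.eq_swap⟩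

/-- Passing to ordered pairs permits summing over `y` with `x` fixed, which is where the parity of
the degrees enters. -/
theorem sum_heawoodFarPairs_add_swap {M : Type*} [AddCommMonoid M]
    (g : ZMod 7 × Fin 3 → ZMod 7 × Fin 3 → M) :
    ∑ z ∈ heawoodFarPairs, (g z.1 z.2 + g z.2 z.1) =
      ∑ x, ∑ y ∈ Finset.univ.filter (HeawoodFar x), g x y := by
  have hswap : ∑ z ∈ heawoodFarPairs, g z.2 z.1 = ∑ z ∈ Finset.univ.filter
      (fun z : (ZMod 7 × Fin 3) × (ZMod 7 × Fin 3) =>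
        HeawoodFar z.1 z.2 ∧ ¬ heawoodIndex z.1 < heawoodIndex z.2), g z.1 z.2 := by
    refine Finset.sum_bij' (fun z _ => z.swap) (fun z _ => z.swap) ?_ ?_ (fun _ _ => rfl)
      (fun _ _ => rfl) (fun _ _ => rfl)
    · intro z hz
      simp only [heawoodFarPairs, Finset.mem_filter] at hz
      exact Finset.mem_filter.2 ⟨Finset.mem_univ _, hz.2.1.symm, hz.2.2.not_gt⟩
    · intro z hz
      rw [Finset.mem_filter] at hz
      refine Finset.mem_filter.2 ⟨Finset.mem_univ _, hz.2.1.symm, ?_⟩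
      exact lt_of_le_of_ne (not_lt.1 hz.2.2) fun h =>
        hz.2.1.1 (congrArg Prod.fst (heawoodIndex_injective h).symm)
  rw [Finset.sum_add_distrib, hswap, heawoodFarPairs, ← Finset.filter_filter,
    ← Finset.filter_filter, Finset.sum_filter_add_sum_filter_not]
  rw [Finset.sum_filter, Fintype.sum_prod_type]
  exact Finset.sum_congr rfl fun x _ => (Finset.sum_filter _ _).symm

/-- Each vertex is an end of an even number of edges at distance two from a given edge. -/
theorem sum_heawoodFar_eq_zero (x : ZMod 7 × Fin 3) (N : ZMod 7 → ZMod 2) :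
    ∑ y ∈ Finset.univ.filter (HeawoodFar x), N y.1 = 0 ∧
      ∑ y ∈ Finset.univ.filter (HeawoodFar x), N (heawoodEnd y) = 0 := by
  -- For an edge `uv`, a vertex `u i` not adjacent to `v` has exactly one common neighbour with `u`,
  -- hence two edges at distance two from `uv`; other `u i` have none. The case of `v j` is
  -- symmetric.
  have h₁ : ∀ x : ZMod 7 × Fin 3, ∀ i : ZMod 7, Even
      ((Finset.univ.filter (HeawoodFar x)).filter fun y => y.1 = i).card := by
    decide +kernel
  have h₂ : ∀ x : ZMod 7 × Fin 3, ∀ i : ZMod 7, Even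
      ((Finset.univ.filter (HeawoodFar x)).filter fun y => heawoodEnd y = i).card := by
    decide +kernel
  constructor
  · rw [Finset.sum_comp N Prod.fst]
    refine Finset.sum_eq_zero fun i _ => ?_
    rw [nsmul_eq_mul, ZMod.natCast_eq_zero_iff_even.2 (h₁ x i), zero_mul]
  · rw [Finset.sum_comp N heawoodEnd]
    refine Finset.sum_eq_zero fun i _ => ?_
    rw [nsmul_eq_mul, ZMod.natCast_eq_zero_iff_even.2 (h₂ x i), zero_mul]

/-- A linear order of the vertices of the Heawood graph. -/
def heawoodRank : ZMod 7 ⊕ ZMod 7 → ℕ :=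
  Sum.elim ZMod.val fun j => 7 + j.val

theorem heawoodRank_injective : Function.Injective heawoodRank := by
  rintro (i | i) (j | j) h
  · exact congrArg Sum.inl (ZMod.val_injective 7 h)
  · have := ZMod.val_lt i
    simp only [heawoodRank, Sum.elim_inl, Sum.elim_inr] at h
    omega
  · have := ZMod.val_lt j
    simp only [heawoodRank, Sum.elim_inl, Sum.elim_inr] at h
    omega
  · exact congrArg Sum.inr (ZMod.val_injective 7 (Nat.add_left_cancel h))

end SimpleGraph

/-! ### Reduction to the convex drawing. -/

open SimpleGraph in
theorem theorem1p7
    (f : SimpleGraph.heawoodGraph.Realization → EuclideanSpace ℝ (Fin 2))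
    (hf : SimpleGraph.heawoodGraph.IsPlaneGenericImmersion f) :
    Odd (∑ P ∈ SimpleGraph.heawoodGraph.edgePairsAtDist 2,
      SimpleGraph.heawoodGraph.crossingNumber f P) := by
  obtain ⟨n, hn⟩ := hf.exists_crossingNumber_eq heawoodRank_injective
  -- The number mod 2 of crossings between edges at distance two, in the convex drawing with
  -- vertices in the order `u 0, ..., u 6, v 0, ..., v 6`.
  have hconvex : ∑ z ∈ heawoodFarPairs,
      ((if heawoodRank (Sum.inl z.2.1) < heawoodRank (Sum.inr (heawoodEnd z.1)) then 1 else 0) +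
        (if heawoodRank (Sum.inl z.2.1) < heawoodRank (Sum.inl z.1.1) then 1 else 0) +
        (if heawoodRank (Sum.inr (heawoodEnd z.2)) < heawoodRank (Sum.inr (heawoodEnd z.1))
          then 1 else 0) +
        (if heawoodRank (Sum.inr (heawoodEnd z.2)) < heawoodRank (Sum.inl z.1.1)
          then 1 else 0) : ZMod 2) = 1 := by
    decide +kernel
  rw [← ZMod.natCast_eq_one_iff_odd, sum_edgePairsAtDist_heawoodGraph, Nat.cast_sum, ← hconvex]
  set g : ZMod 7 × Fin 3 → ZMod 7 × Fin 3 → ZMod 2 := fun x y =>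
    n (Sum.inl x.1) (Sum.inr (heawoodEnd x)) (Sum.inl y.1) +
      n (Sum.inl x.1) (Sum.inr (heawoodEnd x)) (Sum.inr (heawoodEnd y)) with hg
  -- For fixed `x`, the term `g x y` is a sum over the two ends of `y`, and each vertex occurs an
  -- even number of times.
  have hg0 : ∑ z ∈ heawoodFarPairs, (g z.1 z.2 + g z.2 z.1) = 0 := by
    rw [sum_heawoodFarPairs_add_swap]
    refine Finset.sum_eq_zero fun x _ => ?_
    rw [Finset.sum_add_distrib,
      (sum_heawoodFar_eq_zero x fun i => n (Sum.inl x.1) (Sum.inr (heawoodEnd x)) (Sum.inl i)).1,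
      (sum_heawoodFar_eq_zero x fun i => n (Sum.inl x.1) (Sum.inr (heawoodEnd x)) (Sum.inr i)).2,
      add_zero]
  refine Eq.trans ?_ ((congrArg (· + _) hg0).trans (zero_add _))
  refine Eq.trans ?_ Finset.sum_add_distrib
  refine Finset.sum_congr rfl fun z hz => ?_
  obtain ⟨-, hfar, -⟩ := Finset.mem_filter.1 hz
  exact hn _ _ _ _ (heawoodGraph_adj z.1) (heawoodGraph_adj z.2) (by simpa using hfar.1) (by simp)
    (by simp) (by simpa using hfar.2.1)
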